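/- Let $k$ be an algebraically closed field of characteristic zero. A smooth variety means an integral separated scheme, smooth and of finite type over $k$. Let $n\ge 0$ be an integer. For a smooth variety $X$ (of any dimension) let $T^*_X=\operatorname{Spec}_X \operatorname{Sym}(T_X)$ be its cotangent bundle, where $T_X$ denotes the dual of the sheaf $\Omega_{X/k}$, and let $$\mathrm{Chow}^n(T^*_X/X)=\operatorname{Spec}_X\Big(\big(\operatorname{Sym}(T_X)^{\otimes n}\big)^{\mathfrak S_n}\Big)\longrightarrow X$$ be the relative Chow scheme of $n$ points on $T^*_X$ over $X$, that is, the quotient of the $n$-fold fibre power $T^*_X\times_X\cdots\times_X T^*_X$ by the symmetric group. The space of spectral data $\mathscr A_X=\mathrm{Sect}(X,\mathrm{Chow}^n(T^*_X/X))$ is the functor on $k$-schemes whose $T$-points are the $X$-morphisms $X\times_k T\to \mathrm{Chow}^n(T^*_X/X)$; equivalently, the sections over $X_T=X\times_kT$ of $\mathrm{Chow}^n(T^*_{X_T/T}/X_T)$. Let $\chi:X'\to X$ be a proper birational morphism of smooth varieties over $k$. Pullback of differential forms along $\chi$ induces a morphism of $X'$-schemes $\mathrm{Chow}^n(T^*_X/X)\times_X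 X'\to\mathrm{Chow}^n(T^*_{X'}/X')$. Pulling back sections along $\chi\times \mathrm{id}_T:X'_T\to X_T$ and composing with this morphism defines the natural morphism $\mathscr A_X\to\mathscr A_{X'}$. Then the natural morphism $\mathscr A_X\to\mathscr A_{X'}$ is an isomorphism: it is bijective on $T$-points for every $k$-scheme $T$. In particular, whenever $\mathscr A_X$ and $\mathscr A_{X'}$ are represented by $k$-schemes, it is given by an isomorphism of these $k$-schemes. -/

import Mathlib

open CategoryTheory AlgebraicGeometry Opposite Limits
open scoped TensorProduct

universe u

noncomputable section

set_option linter.unusedSectionVars false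

namespace SpectralData

section Multisymmetric

variable (n : ℕ) (R : Type u) [CommRing R] (M : Type u) [AddCommGroup M] [Module R M]

/-- The algebra `SymmetricAlgebra R (Fin n → M)` is `Sym(M) ⊗ ... ⊗ Sym(M)` (`n` factors), the ring of
functions on the `n`-fold fibre power `V ×_R ... ×_R V` of `V = Spec Sym(M)`. A permutation of
`Fin n` acts on it by permuting the `n` factors. -/
def permHom (σ : Equiv.Perm (Fin n)) :
    SymmetricAlgebra R (Fin n → M) →ₐ[R] SymmetricAlgebra R (Fin n → M) :=
  SymmetricAlgebra.lift (SymmetricAlgebra.ι R (Fin n → M) ∘ₗ LinearMap.funLeft R M σ)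

/-- The invariants of the symmetric group in `SymmetricAlgebra R (Fin n → M)`: the ring of functions on
the relative Chow scheme `Chow^n(V) = (V ×_R ... ×_R V) / S_n` of `n` points on `V = Spec Sym(M)`. -/
def multisym : Subalgebra R (SymmetricAlgebra R (Fin n → M)) :=
  ⨅ σ : Equiv.Perm (Fin n), AlgHom.equalizer (permHom n R M σ) (AlgHom.id R _)

variable {n R M}

theorem mem_multisym {p : SymmetricAlgebra R (Fin n → M)} :
    p ∈ multisym n R M ↔ ∀ σ, permHom n R M σ p = p := by
  simp [multisym, Algebra.mem_iInf]

theorem permHom_permHom (σ τ : Equiv.Perm (Fin n)) (p : SymmetricAlgebra R (Fin n → M)) :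
    permHom n R M σ (permHom n R M τ p) = permHom n R M (τ * σ) p := by
  suffices h : (permHom n R M σ).comp (permHom n R M τ) = permHom n R M (τ * σ) from
    DFunLike.congr_fun h p
  ext v
  simp [permHom, LinearMap.funLeft, Function.comp_assoc]
  
section BaseChange

variable {S : Type u} [CommRing S] [Algebra R S] {N : Type u} [AddCommGroup N] [Module S N]
  [Module R N] [IsScalarTower R S N]

/-- The map induced on `n`-fold tensor powers of symmetric algebras by a semilinear map `l : M → N`. -/
def powMap (l : M →ₗ[R] N) :
    SymmetricAlgebra R (Fin n → M) →ₐ[R] SymmetricAlgebra S (Fin n → N) :=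
  SymmetricAlgebra.lift ((SymmetricAlgebra.ι S (Fin n → N)).restrictScalars R ∘ₗ l.compLeft (Fin n))

theorem powMap_permHom (l : M →ₗ[R] N) (σ : Equiv.Perm (Fin n)) (p) :
    powMap (S := S) l (permHom n R M σ p) = permHom n S N σ (powMap l p) := by
  suffices h : (powMap (S := S) l).comp (permHom n R M σ) =
      ((permHom n S N σ).restrictScalars R).comp (powMap l) from DFunLike.congr_fun h p
  ext v
  simp [permHom, powMap, LinearMap.funLeft]
  rfl

theorem powMap_ι (l : M →ₗ[R] N) (v : Fin n → M) :
    powMap (S := S) l (SymmetricAlgebra.ι R _ v) = SymmetricAlgebra.ι S _ (fun i ↦ l (v i)) := by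
  simp [powMap]; rfl

theorem isBaseChange_powMap {l : M →ₗ[R] N} (hl : IsBaseChange S l) :
    IsBaseChange S (powMap (n := n) (S := S) l).toLinearMap := by
  have hp : IsBaseChange S (l.compLeft (Fin n)) := hl.finitePow (Fin n)
  let F : S ⊗[R] SymmetricAlgebra R (Fin n → M) →ₐ[S] SymmetricAlgebra S (Fin n → N) :=
    Algebra.TensorProduct.lift (Algebra.ofId S _) (powMap l) (fun _ _ ↦ Commute.all _ _)
  let G : SymmetricAlgebra S (Fin n → N) →ₐ[S] S ⊗[R] SymmetricAlgebra R (Fin n → M) :=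
    SymmetricAlgebra.lift (hp.lift
      (Algebra.TensorProduct.includeRight.toLinearMap ∘ₗ SymmetricAlgebra.ι R (Fin n → M)))
  have hG (v : Fin n → M) : G (SymmetricAlgebra.ι S _ (fun i ↦ l (v i))) =
      1 ⊗ₜ SymmetricAlgebra.ι R _ v := by
    simp only [G, SymmetricAlgebra.lift_ι_apply]
    exact hp.lift_eq _ v
  have hF (v : Fin n → M) : F (1 ⊗ₜ SymmetricAlgebra.ι R _ v) =
      (SymmetricAlgebra.ι S _ (fun i ↦ l (v i))) := by
    simp [F, powMap_ι]
  have hFG : F.comp G = AlgHom.id S _ := by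
    apply SymmetricAlgebra.algHom_ext
    apply hp.algHom_ext
    intro v
    change F (G (SymmetricAlgebra.ι S _ (fun i ↦ l (v i)))) = SymmetricAlgebra.ι S _ (fun i ↦ l (v i))
    rw [hG, hF]
  have hGF : G.comp F = AlgHom.id S _ := by
    apply Algebra.TensorProduct.ext
    · ext
    · apply SymmetricAlgebra.algHom_ext
      refine LinearMap.ext fun v ↦ ?_
      change G (F (1 ⊗ₜ SymmetricAlgebra.ι R _ v)) = 1 ⊗ₜ SymmetricAlgebra.ι R _ v
      rw [hF, hG]
  refine IsBaseChange.of_equiv (AlgEquiv.ofAlgHom F G hFG hGF).toLinearEquiv fun x ↦ ?_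
  change F (1 ⊗ₜ x) = powMap l x
  simp [F]

/-- The map induced by `l : M → N` on invariants. -/
def multisymMap (l : M →ₗ[R] N) : multisym n R M →ₐ[R] multisym n S N :=
  ((powMap l).comp (multisym n R M).val).codRestrict ((multisym n S N).restrictScalars R)
    fun p ↦ by
      have hp := mem_multisym.mp p.2
      refine mem_multisym.mpr fun σ ↦ ?_
      change permHom n S N σ (powMap l p) = powMap l p
      rw [← powMap_permHom, hp]

theorem multisymMap_coe (l : M →ₗ[R] N) (p : multisym n R M) :
    (multisymMap (S := S) l p : SymmetricAlgebra S (Fin n → N)) = powMap l p := rfl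

theorem multisymMap_isLocalizedModule (f : R) [IsLocalization.Away f S] {l : M →ₗ[R] N}
    (hl : IsLocalizedModule (.powers f) l) :
    IsLocalizedModule (.powers f) (multisymMap (n := n) (S := S) l).toLinearMap := by
  have hb : IsLocalizedModule (.powers f) (powMap (n := n) (S := S) l).toLinearMap :=
    (isLocalizedModule_iff_isBaseChange (.powers f) S _).mpr
      (isBaseChange_powMap ((isLocalizedModule_iff_isBaseChange (.powers f) S l).mp hl))
  constructor
  · intro x
    have hu : IsUnit (algebraMap R S x) := IsLocalization.map_units S x
    rw [← (Algebra.lmul R (multisym n S N)).commutes, Algebra.lmul_isUnit_iff,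
      IsScalarTower.algebraMap_apply R S]
    exact hu.map _
  · intro y
    obtain ⟨⟨x, s⟩, h⟩ := IsLocalizedModule.surj (.powers f)
      (powMap (n := n) (S := S) l).toLinearMap (y : SymmetricAlgebra S (Fin n → N))
    have h1 (σ : Equiv.Perm (Fin n)) : ∃ c : Submonoid.powers f,
        c • permHom n R M σ x = c • x := by
      apply hb.exists_of_eq
      change powMap (S := S) l (permHom n R M σ x) = powMap l x
      rw [powMap_permHom]
      change s • (y : SymmetricAlgebra S (Fin n → N)) = powMap l x at h
      rw [← h, Submonoid.smul_def, ← IsScalarTower.algebraMap_smul S (s : R), map_smul,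
        mem_multisym.mp y.2]
    choose c hc using h1
    refine ⟨⟨⟨(∏ σ, c σ) • x, mem_multisym.mpr fun σ ↦ ?_⟩, (∏ σ, c σ) * s⟩, ?_⟩
    · rw [Submonoid.smul_def, map_smul, ← Submonoid.smul_def,
        ← Finset.mul_prod_erase _ _ (Finset.mem_univ σ), mul_comm,
        Submonoid.smul_def, Submonoid.coe_mul, mul_smul, mul_smul]
      exact congrArg _ (hc σ)
    · apply Subtype.ext
      change ((∏ σ, c σ) * s) • (y : SymmetricAlgebra S (Fin n → N)) = powMap l ((∏ σ, c σ) • x)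
      rw [mul_smul, h, Submonoid.smul_def, Submonoid.smul_def, map_smul]
      rfl
  · intro x y h
    obtain ⟨c, hc⟩ := hb.exists_of_eq (x₁ := (x : SymmetricAlgebra R (Fin n → M))) (x₂ := y)
      (congrArg Subtype.val h)
    exact ⟨c, Subtype.ext hc⟩

end BaseChange

variable (n R M) in
/-- The averaging (Reynolds) operator `p ↦ (1/n!) ∑ σ, σ p`, a retraction onto the invariants when `n!`
is invertible in `R`. -/
def average : SymmetricAlgebra R (Fin n → M) →ₗ[R] multisym n R M :=
  LinearMap.codRestrict (Subalgebra.toSubmodule (multisym n R M))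
    (Ring.inverse (n.factorial : R) • ∑ σ, (permHom n R M σ).toLinearMap) fun p ↦ by
      refine mem_multisym.mpr fun τ ↦ ?_
      simp only [LinearMap.smul_apply, LinearMap.sum_apply, AlgHom.toLinearMap_apply, map_smul,
        map_sum, permHom_permHom]
      congr 1
      exact Fintype.sum_equiv (Equiv.mulRight τ) _ _ fun σ ↦ rfl

theorem average_coe (p : SymmetricAlgebra R (Fin n → M)) :
    (average n R M p : SymmetricAlgebra R (Fin n → M)) =
      Ring.inverse (n.factorial : R) • ∑ σ, permHom n R M σ p := by
  simp [average, LinearMap.codRestrict]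

theorem average_mul (q : multisym n R M) (p : SymmetricAlgebra R (Fin n → M)) :
    average n R M (q * p) = q * average n R M p := by
  apply Subtype.ext
  rw [Subalgebra.coe_mul, average_coe, average_coe, mul_smul_comm, Finset.mul_sum]
  congr 1
  exact Finset.sum_congr rfl fun σ _ ↦ by rw [map_mul, mem_multisym.mp q.2]

variable {B : Type u} [CommRing B] [Algebra R B]

/-- The averaging retraction of `B ⊗ Sym(M)^{⊗ n}` onto `B ⊗ (Sym(M)^{⊗ n})^{S_n}`, followed by the
`B`-linear map to `B` given by a `B`-point `φ` of `Chow^n(V)`. On the invariants of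
`B ⊗ Sym(M)^{⊗ n}`, which are the functions on `Chow^n(V)_B`, it is the point `φ` itself. -/
def extendPoint (φ : multisym n R M →ₐ[R] B) :
    B ⊗[R] SymmetricAlgebra R (Fin n → M) →ₗ[B] B :=
  (φ.toLinearMap ∘ₗ average n R M).liftBaseChange B

theorem extendPoint_tmul (φ : multisym n R M →ₐ[R] B) (b : B) (p) :
    extendPoint φ (b ⊗ₜ p) = b * φ (average n R M p) := by
  simp [extendPoint]

theorem extendPoint_mul (φ : multisym n R M →ₐ[R] B) (b : B) (q : multisym n R M) (y) :
    extendPoint φ ((b ⊗ₜ (q : SymmetricAlgebra R (Fin n → M))) * y) = b * φ q * extendPoint φ y := by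
  induction y with
  | zero => simp
  | add x y hx hy => rw [mul_add, map_add, hx, hy, map_add, mul_add]
  | tmul c p =>
    rw [Algebra.TensorProduct.tmul_mul_tmul, extendPoint_tmul, extendPoint_tmul, average_mul,
      map_mul]
    ring

/-- The action of a permutation on `B ⊗ Sym(M)^{⊗ n}`. -/
def permTensor (σ : Equiv.Perm (Fin n)) :
    B ⊗[R] SymmetricAlgebra R (Fin n → M) →ₐ[B] B ⊗[R] SymmetricAlgebra R (Fin n → M) :=
  Algebra.TensorProduct.map (AlgHom.id B B) (permHom n R M σ)

theorem sum_permTensor (y : B ⊗[R] SymmetricAlgebra R (Fin n → M)) :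
    algebraMap R B (Ring.inverse (n.factorial : R)) • ∑ σ, permTensor σ y =
      LinearMap.baseChange B ((multisym n R M).val.toLinearMap ∘ₗ average n R M) y := by
  induction y with
  | zero => simp
  | add x y hx hy => simp only [map_add, Finset.sum_add_distrib, smul_add, hx, hy]
  | tmul c p =>
    simp [permTensor, average_coe, ← TensorProduct.tmul_sum, algebraMap_smul]

theorem extendPoint_mul_of_invariant (hn : IsUnit (n.factorial : R))
    (φ : multisym n R M →ₐ[R] B) {x : B ⊗[R] SymmetricAlgebra R (Fin n → M)}
    (hx : ∀ σ, permTensor σ x = x) (y) :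
    extendPoint φ (x * y) = extendPoint φ x * extendPoint φ y := by
  have h : x = LinearMap.baseChange B ((multisym n R M).val.toLinearMap ∘ₗ average n R M) x := by
    rw [← sum_permTensor, Finset.sum_congr rfl fun σ _ ↦ hx σ, Finset.sum_const, Finset.card_univ,
      Fintype.card_perm, Fintype.card_fin, ← Nat.cast_smul_eq_nsmul B, smul_smul,
      ← map_natCast (algebraMap R B), ← map_mul, Ring.inverse_mul_cancel _ hn, map_one, one_smul]
  have key : ∀ z : B ⊗[R] SymmetricAlgebra R (Fin n → M), 
      extendPoint φ ((LinearMap.baseChange B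
        ((multisym n R M).val.toLinearMap ∘ₗ average n R M) z) * y) =
      extendPoint φ z * extendPoint φ y := by
    intro z
    induction z with
    | zero => simp
    | add x y hx hy => simp only [map_add, add_mul, hx, hy]
    | tmul c p =>
      rw [LinearMap.baseChange_tmul, extendPoint_tmul]
      exact extendPoint_mul φ c (average n R M p) y
  rw [← key x, ← h]

theorem extendPoint_one (hn : IsUnit (n.factorial : R)) (φ : multisym n R M →ₐ[R] B) (b : B) :
    extendPoint φ (b ⊗ₜ 1) = b := by
  have : average n R M 1 = 1 := by
    apply Subtype.ext
    rw [average_coe, Finset.sum_congr rfl fun σ _ ↦ map_one (permHom n R M σ), Finset.sum_const,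
      Finset.card_univ, Fintype.card_perm, Fintype.card_fin, ← Nat.cast_smul_eq_nsmul R, smul_smul,
      Ring.inverse_mul_cancel _ hn, one_smul]
    rfl
  rw [extendPoint_tmul, this, map_one, mul_one]

theorem permTensor_single (σ : Equiv.Perm (Fin n)) (i : Fin n) (z : B ⊗[R] M) :
    permTensor σ (LinearMap.lTensor B
      (SymmetricAlgebra.ι R (Fin n → M) ∘ₗ LinearMap.single R (fun _ ↦ M) (σ i)) z) =
    LinearMap.lTensor B
      (SymmetricAlgebra.ι R (Fin n → M) ∘ₗ LinearMap.single R (fun _ ↦ M) i) z := by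
  induction z with
  | zero => simp
  | add x y hx hy => simp only [map_add, hx, hy]
  | tmul b m =>
    simp only [permTensor, permHom, LinearMap.lTensor_tmul, LinearMap.comp_apply,
      Algebra.TensorProduct.map_tmul, AlgHom.id_apply, SymmetricAlgebra.lift_ι_apply]
    congr 2
    ext j
    by_cases h : j = i
    · subst h; simp [LinearMap.funLeft]
    · simp [LinearMap.funLeft, h]

variable {S : Type u} [CommRing S] [Algebra R S] [Algebra S B] [IsScalarTower R S B]
  {N : Type u} [AddCommGroup N] [Module S N]

variable (n) in
/-- The map on functions on `n`-fold fibre powers `W^n ← V_B^n` given by a map of vector bundles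
`V_B → W_B`, where `V = Spec Sym(M)` over `R`, `W = Spec Sym(N)` over `S`, and the map of vector
bundles is dual to `d : N → B ⊗ M`. -/
def powTensor (d : N →ₗ[S] B ⊗[R] M) :
    SymmetricAlgebra S (Fin n → N) →ₐ[S] B ⊗[R] SymmetricAlgebra R (Fin n → M) :=
  SymmetricAlgebra.lift (∑ i, TensorProduct.AlgebraTensorModule.lTensor S B
    (SymmetricAlgebra.ι R (Fin n → M) ∘ₗ LinearMap.single R (fun _ ↦ M) i) ∘ₗ d ∘ₗ
      LinearMap.proj i)

theorem powTensor_ι (d : N →ₗ[S] B ⊗[R] M) (v : Fin n → N) :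
    powTensor n d (SymmetricAlgebra.ι S _ v) =
      ∑ i, LinearMap.lTensor B
        (SymmetricAlgebra.ι R (Fin n → M) ∘ₗ LinearMap.single R (fun _ ↦ M) i) (d (v i)) := by
  simp [powTensor]

theorem powTensor_permHom (d : N →ₗ[S] B ⊗[R] M) (σ : Equiv.Perm (Fin n)) (p) :
    powTensor n d (permHom n S N σ p) = permTensor σ (powTensor n d p) := by
  suffices h : (powTensor n d).comp (permHom n S N σ) =
      ((permTensor σ).restrictScalars S).comp (powTensor n d) from DFunLike.congr_fun h p
  apply SymmetricAlgebra.algHom_ext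
  refine LinearMap.ext fun v ↦ ?_
  change powTensor n d (permHom n S N σ (SymmetricAlgebra.ι S _ v)) =
    permTensor σ (powTensor n d (SymmetricAlgebra.ι S _ v))
  rw [permHom, SymmetricAlgebra.lift_ι_apply, LinearMap.comp_apply, powTensor_ι, powTensor_ι,
    map_sum]
  refine Fintype.sum_equiv σ _ _ fun i ↦ ?_
  rw [permTensor_single]
  rfl

/-- The image of a `B`-point `φ` of `Chow^n(V)` under the morphism `Chow^n(V_B) → Chow^n(W_B)` induced by
the map of vector bundles `V_B → W_B` dual to `d : N → B ⊗ M`: restrict the functions on `W^n` to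
`V_B^n`, where invariant functions go to invariant functions, and evaluate them at `φ`. -/
def pushPoint (hn : IsUnit (n.factorial : R)) (d : N →ₗ[S] B ⊗[R] M)
    (φ : multisym n R M →ₐ[R] B) : multisym n S N →ₐ[S] B :=
  AlgHom.ofLinearMap
    ((extendPoint φ).restrictScalars S ∘ₗ (powTensor n d).toLinearMap ∘ₗ
      (multisym n S N).val.toLinearMap)
    ((congrArg (extendPoint φ) (map_one (powTensor n d))).trans (extendPoint_one hn φ 1))
    fun x y ↦ by
      have := extendPoint_mul_of_invariant hn φ (x := powTensor n d x)
        (fun σ ↦ by rw [← powTensor_permHom, mem_multisym.mp x.2]) (powTensor n d y)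
      rw [← map_mul] at this
      exact this

theorem pushPoint_apply (hn : IsUnit (n.factorial : R)) (d : N →ₗ[S] B ⊗[R] M)
    (φ : multisym n R M →ₐ[R] B) (p : multisym n S N) :
    pushPoint hn d φ p = extendPoint φ (powTensor n d p) := rfl

end Multisymmetric

section Naturality

variable {n : ℕ} {R S B R₂ S₂ B₂ M N M₂ N₂ : Type u}
  [CommRing R] [CommRing S] [CommRing B] [CommRing R₂] [CommRing S₂] [CommRing B₂]
  [AddCommGroup M] [Module R M] [AddCommGroup N] [Module S N]
  [AddCommGroup M₂] [Module R₂ M₂] [Module R M₂] [AddCommGroup N₂] [Module S₂ N₂] [Module S N₂]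
  [Algebra R S] [Algebra R B] [Algebra S B] [IsScalarTower R S B]
  [Algebra R₂ S₂] [Algebra R₂ B₂] [Algebra S₂ B₂] [IsScalarTower R₂ S₂ B₂]
  [Algebra R R₂] [Algebra S S₂] [Algebra B B₂] [Algebra R B₂] [Algebra S B₂]
  [IsScalarTower R R₂ M₂] [IsScalarTower S S₂ N₂]
  [IsScalarTower R R₂ B₂] [IsScalarTower R B B₂] [IsScalarTower S S₂ B₂] [IsScalarTower S B B₂]

variable (B B₂) in
/-- The map `B ⊗ M → B₂ ⊗ M₂` induced by maps of the factors. -/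
def tensorMap (l : M →ₗ[R] M₂) : B ⊗[R] M →ₗ[R] B₂ ⊗[R₂] M₂ :=
  TensorProduct.mapOfCompatibleSMul R₂ R R B₂ M₂ ∘ₗ
    TensorProduct.map (IsScalarTower.toAlgHom R B B₂).toLinearMap l

theorem tensorMap_tmul (l : M →ₗ[R] M₂) (b : B) (m : M) :
    tensorMap B B₂ (R₂ := R₂) l (b ⊗ₜ m) = algebraMap B B₂ b ⊗ₜ l m := rfl

theorem average_powMap (hn : IsUnit (n.factorial : R)) (l : M →ₗ[R] M₂)
    (p : SymmetricAlgebra R (Fin n → M)) :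
    average n R₂ M₂ (powMap l p) = multisymMap l (average n R M p) := by
  have hi : Ring.inverse (n.factorial : R₂) = algebraMap R R₂ (Ring.inverse (n.factorial : R)) := by
    have h1 : (n.factorial : R₂) = algebraMap R R₂ (n.factorial : R) := (map_natCast _ _).symm
    refine (hn.map (algebraMap R R₂)).mul_left_cancel ?_
    rw [← map_mul, Ring.mul_inverse_cancel _ hn, ← h1, Ring.mul_inverse_cancel, map_one]
    rw [h1]
    exact hn.map _
  apply Subtype.ext
  rw [multisymMap_coe, average_coe, average_coe, hi, algebraMap_smul, map_smul, map_sum]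
  simp only [powMap_permHom]

theorem extendPoint_tensorMap (hn : IsUnit (n.factorial : R)) (l : M →ₗ[R] M₂) (φ : multisym n R M →ₐ[R] B)
    (φ₂ : multisym n R₂ M₂ →ₐ[R₂] B₂)
    (h : ∀ q, φ₂ (multisymMap l q) = algebraMap B B₂ (φ q)) (x) :
    extendPoint φ₂ (tensorMap B B₂ (R₂ := R₂) (powMap (n := n) l).toLinearMap x) =
      algebraMap B B₂ (extendPoint φ x) := by
  induction x with
  | zero => simp
  | add x y hx hy => simp only [map_add, hx, hy]
  | tmul b p =>
    rw [tensorMap_tmul, extendPoint_tmul, extendPoint_tmul, map_mul, ← h]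
    congr 2
    exact average_powMap hn l p

theorem tensorMap_powTensor (l : M →ₗ[R] M₂) (e : N →ₗ[S] N₂) (d : N →ₗ[S] B ⊗[R] M)
    (d₂ : N₂ →ₗ[S₂] B₂ ⊗[R₂] M₂) (hd : ∀ ν, d₂ (e ν) = tensorMap B B₂ l (d ν)) (x) :
    powTensor n d₂ (powMap e x) =
      tensorMap B B₂ (R₂ := R₂) (powMap (n := n) l).toLinearMap (powTensor n d x) := by
  let Θ : B ⊗[R] SymmetricAlgebra R (Fin n → M) →ₐ[R] B₂ ⊗[R₂] SymmetricAlgebra R₂ (Fin n → M₂) :=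
    Algebra.TensorProduct.lift
      ((Algebra.TensorProduct.includeLeft (S := R₂)).restrictScalars R |>.comp
        (IsScalarTower.toAlgHom R B B₂))
      (((Algebra.TensorProduct.includeRight).restrictScalars R).comp (powMap l))
      (fun _ _ ↦ Commute.all _ _)
  have hΘ (y) : tensorMap B B₂ (R₂ := R₂) (powMap (n := n) l).toLinearMap y = Θ y := by
    induction y with
    | zero => simp
    | add x y hx hy => simp only [map_add, hx, hy]
    | tmul b p =>
      simp [tensorMap_tmul, Θ]
  have hs (i : Fin n) (z : B ⊗[R] M) :
      LinearMap.lTensor B₂ (SymmetricAlgebra.ι R₂ (Fin n → M₂) ∘ₗ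
        LinearMap.single R₂ (fun _ ↦ M₂) i) (tensorMap B B₂ l z) =
      tensorMap B B₂ (R₂ := R₂) (powMap (n := n) l).toLinearMap
        (LinearMap.lTensor B (SymmetricAlgebra.ι R (Fin n → M) ∘ₗ
          LinearMap.single R (fun _ ↦ M) i) z) := by
    induction z with
    | zero => simp
    | add x y hx hy => simp only [map_add, hx, hy]
    | tmul b m =>
      simp only [tensorMap_tmul, LinearMap.lTensor_tmul, LinearMap.comp_apply,
        AlgHom.toLinearMap_apply, powMap_ι]
      congr 2
      ext j
      by_cases h : j = i
      · subst h; simp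
      · simp [h]
  induction x using SymmetricAlgebra.induction with
  | algebraMap s =>
    rw [hΘ, AlgHom.commutes, AlgHom.commutes,
      IsScalarTower.algebraMap_apply S S₂ (SymmetricAlgebra S₂ _), AlgHom.commutes]
    change (algebraMap S₂ B₂ (algebraMap S S₂ s)) ⊗ₜ[R₂] (1 : SymmetricAlgebra R₂ (Fin n → M₂)) =
      Θ (algebraMap S B s ⊗ₜ 1)
    simp [Θ, ← IsScalarTower.algebraMap_apply]
  | ι v =>
    rw [powMap_ι, powTensor_ι, powTensor_ι, map_sum]
    exact Finset.sum_congr rfl fun i _ ↦ by rw [hd, hs]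
  | mul x y hx hy => simp only [map_mul, hx, hy, hΘ]
  | add x y hx hy => simp only [map_add, hx, hy]

theorem pushPoint_naturality (hn : IsUnit (n.factorial : R)) (hn₂ : IsUnit (n.factorial : R₂))
    (l : M →ₗ[R] M₂) (e : N →ₗ[S] N₂) (d : N →ₗ[S] B ⊗[R] M)
    (d₂ : N₂ →ₗ[S₂] B₂ ⊗[R₂] M₂) (hd : ∀ ν, d₂ (e ν) = tensorMap B B₂ l (d ν))
    (φ : multisym n R M →ₐ[R] B) (φ₂ : multisym n R₂ M₂ →ₐ[R₂] B₂)
    (h : ∀ q, φ₂ (multisymMap l q) = algebraMap B B₂ (φ q)) (p : multisym n S N) :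
    pushPoint hn₂ d₂ φ₂ (multisymMap e p) = algebraMap B B₂ (pushPoint hn d φ p) := by
  rw [pushPoint_apply, pushPoint_apply, multisymMap_coe,
    tensorMap_powTensor l e d d₂ hd, extendPoint_tensorMap hn l φ φ₂ h]

end Naturality

section Tangent

variable (k : Type u) [CommRing k]

/-- Vector fields: the dual of the module of differentials. For `R` smooth over `k`, the cotangent bundle
of `Spec R` is the spectrum of the symmetric algebra of this module. -/
abbrev Tangent (R : Type u) [CommRing R] [Algebra k R] : Type u := Module.Dual R Ω[R⁄k]

variable (R S : Type u) [CommRing R] [Algebra k R] [CommRing S] [Algebra k S]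
  [Algebra R S] [IsScalarTower k R S]

/-- Restriction of vector fields along a formally etale ring map (below: to a basic open subset). -/
def tangentMap [Algebra.FormallyEtale R S] : Tangent k R →ₗ[R] Tangent k S :=
  (KaehlerDifferential.isBaseChange_of_formallyEtale k R S).toDual

variable {R S}

theorem tangentMap_apply [Algebra.FormallyEtale R S] (ν : Tangent k R) (r : R) :
    tangentMap k R S ν (KaehlerDifferential.D k S (algebraMap R S r)) =
      algebraMap R S (ν (KaehlerDifferential.D k R r)) := by
  have := (KaehlerDifferential.isBaseChange_of_formallyEtale k R S).toDual_comp_apply ν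
    (KaehlerDifferential.D k R r)
  rwa [KaehlerDifferential.map_D] at this

theorem kaehler_ext [Algebra.FormallyEtale R S] {Q : Type u} [AddCommGroup Q] [Module S Q]
    {α β : Ω[S⁄k] →ₗ[S] Q} (h : ∀ r : R, α (KaehlerDifferential.D k S (algebraMap R S r)) =
      β (KaehlerDifferential.D k S (algebraMap R S r))) : α = β := by
  let _ : Module R Q := Module.compHom Q (algebraMap R S)
  have : IsScalarTower R S Q := .of_algebraMap_smul fun _ _ ↦ rfl
  apply (KaehlerDifferential.isBaseChange_of_formallyEtale k R S).algHom_ext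
  suffices h : (α.restrictScalars R) ∘ₗ (KaehlerDifferential.map k k R S) =
      (β.restrictScalars R) ∘ₗ (KaehlerDifferential.map k k R S) from DFunLike.congr_fun h
  apply LinearMap.ext_on_range (KaehlerDifferential.span_range_derivation k R)
  intro r
  simpa using h r

theorem isLocalizedModule_tangentMap [Module.FinitePresentation R Ω[R⁄k]] (f : R)
    [IsLocalization.Away f S] [Algebra.FormallyEtale R S] :
    IsLocalizedModule (.powers f) (tangentMap k R S) := by
  have : tangentMap k R S = IsLocalizedModule.mapExtendScalars (.powers f)
      (KaehlerDifferential.map k k R S) (Algebra.linearMap R S) S := by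
    refine LinearMap.ext fun ν ↦ kaehler_ext k (R := R) fun r ↦ ?_
    rw [tangentMap_apply]
    have := IsLocalizedModule.map_apply (.powers f) (KaehlerDifferential.map k k R S)
      (Algebra.linearMap R S) ν (KaehlerDifferential.D k R r)
    rw [KaehlerDifferential.map_D] at this
    exact this.symm
  rw [this]
  infer_instance

variable (R) in
/-- The identification of `B ⊗ T_R` with `Hom_R(Ω_R, B)`, as a map; it is bijective when `Ω_R` is
finitely generated and projective. -/
def contraction (B : Type u) [CommRing B] [Algebra R B] [Algebra S B] [IsScalarTower R S B] :
    B ⊗[R] Tangent k R →ₗ[S] (Ω[R⁄k] →ₗ[R] B) where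
  toFun x := dualTensorHom R Ω[R⁄k] B (TensorProduct.comm R B _ x)
  map_add' x y := by simp
  map_smul' s x := by
    induction x with
    | zero => simp
    | add x y hx hy => rw [smul_add, map_add, map_add, hx, hy, map_add, map_add, smul_add]
    | tmul b ν =>
      ext ω
      simpa [TensorProduct.smul_tmul', dualTensorHom_apply] using smul_comm _ _ _

theorem contraction_tmul (B : Type u) [CommRing B] [Algebra R B] [Algebra S B] [IsScalarTower R S B]
    (b : B) (ν : Tangent k R) (ω : Ω[R⁄k]) :
    contraction k R (S := S) B (b ⊗ₜ ν) ω = ν ω • b := by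
  simp [contraction, dualTensorHom_apply]

variable (R S) in
/-- A vector field `ν` on `Spec S` gives the linear map `Ω_R → Ω_S → S → B` on differential forms. -/
def pullbackForms (B : Type u) [CommRing B] [Algebra R B] [Algebra S B] [IsScalarTower R S B] :
    Tangent k S →ₗ[S] (Ω[R⁄k] →ₗ[R] B) where
  toFun ν := (Algebra.linearMap S B).restrictScalars R ∘ₗ ν.restrictScalars R ∘ₗ
    KaehlerDifferential.map k k R S
  map_add' x y := by ext; simp
  map_smul' s x := by ext; simp [Algebra.smul_def]

theorem contraction_bijective (B : Type u) [CommRing B] [Algebra R B] [Algebra S B]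
    [IsScalarTower R S B] [Module.Finite R Ω[R⁄k]] [Module.Projective R Ω[R⁄k]] :
    Function.Bijective (contraction k R (S := S) B) :=
  (dualTensorHom_bijective (R := R)).comp (TensorProduct.comm R B _).bijective

variable (R S) in
/-- The differential `T_S → B ⊗ T_R` of `Spec S → Spec R`, over `Spec B → Spec S`. It is dual to the
codifferential, the pullback of differential forms `T^*(Spec R) → T^*(Spec S)` over `Spec B`. -/
def tangentPush (B : Type u) [CommRing B] [Algebra R B] [Algebra S B] [IsScalarTower R S B]
    [Module.Finite R Ω[R⁄k]] [Module.Projective R Ω[R⁄k]] :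
    Tangent k S →ₗ[S] B ⊗[R] Tangent k R :=
  (LinearEquiv.ofBijective _ (contraction_bijective k (R := R) (S := S) B)).symm.toLinearMap ∘ₗ
    pullbackForms k R S B

theorem contraction_tangentPush (B : Type u) [CommRing B] [Algebra R B] [Algebra S B]
    [IsScalarTower R S B] [Module.Finite R Ω[R⁄k]] [Module.Projective R Ω[R⁄k]]
    (ν : Tangent k S) :
    contraction k R (S := S) B (tangentPush k R S B ν) = pullbackForms k R S B ν :=
  LinearEquiv.apply_symm_apply
    (LinearEquiv.ofBijective _ (contraction_bijective k (R := R) (S := S) B)) _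

end Tangent

section TangentNaturality
variable (k : Type u) [CommRing k] {R S B R₂ S₂ B₂ : Type u}
  [CommRing R] [CommRing S] [CommRing B] [CommRing R₂] [CommRing S₂] [CommRing B₂]
  [Algebra k R] [Algebra k S] [Algebra k R₂] [Algebra k S₂]
  [Algebra R S] [Algebra R B] [Algebra S B] [IsScalarTower R S B] [IsScalarTower k R S]
  [Algebra R₂ S₂] [Algebra R₂ B₂] [Algebra S₂ B₂] [IsScalarTower R₂ S₂ B₂] [IsScalarTower k R₂ S₂]
  [Algebra R R₂] [Algebra S S₂] [Algebra R S₂] [Algebra B B₂] [Algebra R B₂] [Algebra S B₂]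
  [IsScalarTower k R R₂] [IsScalarTower k S S₂] [IsScalarTower R R₂ S₂] [IsScalarTower R S S₂]
  [IsScalarTower R R₂ B₂] [IsScalarTower R B B₂] [IsScalarTower S S₂ B₂] [IsScalarTower S B B₂]
  [Module.Finite R Ω[R⁄k]] [Module.Projective R Ω[R⁄k]]
  [Module.Finite R₂ Ω[R₂⁄k]] [Module.Projective R₂ Ω[R₂⁄k]]
  [Algebra.FormallyEtale R R₂] [Algebra.FormallyEtale S S₂]

theorem contraction_tensorMap (x : B ⊗[R] Tangent k R) (r : R) :
    contraction k R₂ (S := S₂) B₂ (tensorMap B B₂ (tangentMap k R R₂) x)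
      (KaehlerDifferential.D k R₂ (algebraMap R R₂ r)) =
    algebraMap B B₂ (contraction k R (S := S) B x (KaehlerDifferential.D k R r)) := by
  induction x with
  | zero => simp
  | add x y hx hy => simp only [map_add, LinearMap.add_apply, hx, hy]
  | tmul b ν =>
    rw [tensorMap_tmul, contraction_tmul, contraction_tmul, tangentMap_apply, algebraMap_smul,
      Algebra.smul_def, Algebra.smul_def, map_mul, ← IsScalarTower.algebraMap_apply]

theorem tangentPush_naturality (ν : Tangent k S) :
    tangentPush k R₂ S₂ B₂ (tangentMap k S S₂ ν) =
      tensorMap B B₂ (tangentMap k R R₂) (tangentPush k R S B ν) := by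
  have hinj : Function.Injective (contraction k R₂ (S := S₂) B₂) :=
    (contraction_bijective k (R := R₂) (S := S₂) B₂).1
  apply hinj
  have hext {α β : Ω[R₂⁄k] →ₗ[R₂] B₂}
      (h : ∀ r : R, α (KaehlerDifferential.D k R₂ (algebraMap R R₂ r)) =
      β (KaehlerDifferential.D k R₂ (algebraMap R R₂ r))) : α = β := kaehler_ext k h
  refine hext fun r ↦ ?_
  rw [contraction_tensorMap k (S := S) (S₂ := S₂), contraction_tangentPush, contraction_tangentPush]
  simp only [pullbackForms, LinearMap.coe_mk, AddHom.coe_mk, LinearMap.comp_apply,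
    KaehlerDifferential.map_D, LinearMap.restrictScalars_apply, Algebra.linearMap_apply]
  rw [← IsScalarTower.algebraMap_apply R R₂ S₂, IsScalarTower.algebraMap_apply R S S₂,
    tangentMap_apply, ← IsScalarTower.algebraMap_apply S S₂ B₂,
    ← IsScalarTower.algebraMap_apply S B B₂]

end TangentNaturality

section ChowRing

variable (k : Type u) [CommRing k] (n : ℕ)

/-- The ring of functions on `Chow^n(T^*_U / U)` for `U = Spec R` smooth over `k`. -/
abbrev ChowRing (R : Type u) [CommRing R] [Algebra k R] : Type u := multisym n R (Tangent k R)

variable {k n} {R S T B : Type u} [CommRing R] [Algebra k R] [CommRing S] [Algebra k S]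
  [CommRing T] [Algebra k T] [CommRing B]

/-- Restriction of functions on `Chow^n` along an etale ring map (below: to a basic open subset). -/
def chowRingMap (f : R →ₐ[k] S) (hf : f.toRingHom.Etale) : ChowRing k n R →+* ChowRing k n S :=
  letI := f.toRingHom.toAlgebra
  haveI : IsScalarTower k R S := .of_algebraMap_eq fun r ↦ (f.commutes r).symm
  haveI : Algebra.Etale R S := hf
  (multisymMap (n := n) (S := S) (tangentMap k R S)).toRingHom

theorem chowRingMap_algebraMap (f : R →ₐ[k] S) (hf : f.toRingHom.Etale) (r : R) :
    chowRingMap (n := n) f hf (algebraMap R _ r) = algebraMap S _ (f r) := by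
  let _ := f.toRingHom.toAlgebra
  have : IsScalarTower k R S := .of_algebraMap_eq fun r ↦ (f.commutes r).symm
  have : Algebra.Etale R S := hf
  exact (multisymMap (n := n) (S := S) (tangentMap k R S)).commutes r

theorem powMap_eq_self {M : Type u} [AddCommGroup M] [Module R M] (l : M →ₗ[R] M)
    (hl : ∀ m, l m = m) (p : SymmetricAlgebra R (Fin n → M)) : powMap (S := R) l p = p := by
  obtain rfl : l = LinearMap.id := LinearMap.ext hl
  induction p using SymmetricAlgebra.induction with
  | algebraMap r => exact AlgHom.commutes _ r
  | ι v => rw [powMap_ι]; rfl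
  | mul x y hx hy => rw [map_mul, hx, hy]
  | add x y hx hy => rw [map_add, hx, hy]

theorem powMap_powMap [Algebra R S] [Algebra S T] [Algebra R T] [IsScalarTower R S T]
    {M N P : Type u} [AddCommGroup M] [Module R M] [AddCommGroup N] [Module R N] [Module S N]
    [IsScalarTower R S N] [AddCommGroup P] [Module R P] [Module S P] [Module T P]
    [IsScalarTower S T P] [IsScalarTower R T P] (l : M →ₗ[R] N) (l' : N →ₗ[S] P) (l'' : M →ₗ[R] P)
    (h : ∀ m, l' (l m) = l'' m) (p : SymmetricAlgebra R (Fin n → M)) :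
    powMap (S := T) l' (powMap (S := S) l p) = powMap (S := T) l'' p := by
  induction p using SymmetricAlgebra.induction with
  | algebraMap r =>
    rw [AlgHom.commutes, AlgHom.commutes, IsScalarTower.algebraMap_apply R S (SymmetricAlgebra S _),
      AlgHom.commutes, ← IsScalarTower.algebraMap_apply]
  | ι v => simp only [powMap_ι, h]
  | mul x y hx hy => simp only [map_mul, hx, hy]
  | add x y hx hy => simp only [map_add, hx, hy]

theorem chowRingMap_id (f : R →ₐ[k] R) (hf : f.toRingHom.Etale) (h : ∀ r, f r = r) :
    chowRingMap (n := n) f hf = RingHom.id _ := by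
  obtain rfl : f = AlgHom.id k R := AlgHom.ext h
  ext p
  have : Algebra.Etale R R := hf
  refine powMap_eq_self (tangentMap k R R) (fun ν ↦ kaehler_ext k (R := R) fun r ↦ ?_) p.1
  rw [tangentMap_apply]
  rfl

theorem chowRingMap_comp (f : R →ₐ[k] S) (hf : f.toRingHom.Etale) (g : S →ₐ[k] T)
    (hg : g.toRingHom.Etale) (h : R →ₐ[k] T) (hh : h.toRingHom.Etale) (e : ∀ r, h r = g (f r)) :
    chowRingMap (n := n) h hh = (chowRingMap g hg).comp (chowRingMap f hf) := by
  let _ := f.toRingHom.toAlgebra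
  let _ := g.toRingHom.toAlgebra
  let _ := h.toRingHom.toAlgebra
  have : IsScalarTower k R S := .of_algebraMap_eq fun r ↦ (f.commutes r).symm
  have : IsScalarTower k S T := .of_algebraMap_eq fun r ↦ (g.commutes r).symm
  have : IsScalarTower k R T := .of_algebraMap_eq fun r ↦ (h.commutes r).symm
  have : IsScalarTower R S T := .of_algebraMap_eq e
  have : Algebra.Etale R S := hf
  have : Algebra.Etale S T := hg
  have : Algebra.Etale R T := hh
  ext p
  refine (powMap_powMap (tangentMap k R S) (tangentMap k S T) (tangentMap k R T)
    (fun ν ↦ kaehler_ext k (R := R) fun r ↦ ?_) p.1).symm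
  rw [tangentMap_apply, IsScalarTower.algebraMap_apply R S T, tangentMap_apply, tangentMap_apply,
    ← IsScalarTower.algebraMap_apply]

theorem isLocalization_chowRingMap [Algebra.Smooth k R] (f : R →ₐ[k] S) (hf : f.toRingHom.Etale)
    (r : R) (hr : @IsLocalization.Away _ _ r S _ f.toRingHom.toAlgebra) :
    @IsLocalization.Away _ _ (algebraMap R (ChowRing k n R) r) (ChowRing k n S) _
      (chowRingMap f hf).toAlgebra := by
  let _ := f.toRingHom.toAlgebra
  have : IsScalarTower k R S := .of_algebraMap_eq fun r ↦ (f.commutes r).symm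
  have : Algebra.Etale R S := hf
  have : Module.FinitePresentation R Ω[R⁄k] := Module.finitePresentation_of_projective _ _
  have hl := multisymMap_isLocalizedModule (n := n) (S := S) r (isLocalizedModule_tangentMap k (S := S) r)
  let _ := (chowRingMap (n := n) f hf).toAlgebra
  have : IsScalarTower R (ChowRing k n R) (ChowRing k n S) :=
    .of_algebraMap_eq fun r ↦ (chowRingMap_algebraMap f hf r).symm
  have h2 := (isLocalizedModule_iff_isLocalization (S := .powers r) (A := ChowRing k n R)
    (Aₛ := ChowRing k n S)).mp hl
  rwa [Algebra.algebraMapSubmonoid_powers] at h2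

/-- For `f : R → S` and a `B`-point `g` of `Spec S`, the map sending a `B`-point `φ` of
`Chow^n(T^*_{Spec R})` lying over `g ∘ f` to a `B`-point of `Chow^n(T^*_{Spec S})` lying over `g`,
induced by the codifferential. -/
def chowRingPush [Algebra.Smooth k R] (hn : IsUnit (n.factorial : R)) (f : R →ₐ[k] S) (g : S →+* B)
    (φ : ChowRing k n R →+* B) (hφ : ∀ r, φ (algebraMap R _ r) = g (f r)) :
    ChowRing k n S →+* B :=
  letI := f.toRingHom.toAlgebra
  letI := g.toAlgebra
  letI := (g.comp f.toRingHom).toAlgebra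
  haveI : IsScalarTower k R S := .of_algebraMap_eq fun r ↦ (f.commutes r).symm
  haveI : IsScalarTower R S B := .of_algebraMap_eq fun _ ↦ rfl
  (pushPoint hn (tangentPush k R S B) { φ with commutes' := hφ }).toRingHom

theorem chowRingPush_algebraMap [Algebra.Smooth k R] (hn : IsUnit (n.factorial : R))
    (f : R →ₐ[k] S) (g : S →+* B)
    (φ : ChowRing k n R →+* B) (hφ : ∀ r, φ (algebraMap R _ r) = g (f r)) (s : S) :
    chowRingPush hn f g φ hφ (algebraMap S _ s) = g s := by
  let _ := f.toRingHom.toAlgebra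
  let _ := g.toAlgebra
  let _ := (g.comp f.toRingHom).toAlgebra
  have : IsScalarTower k R S := .of_algebraMap_eq fun r ↦ (f.commutes r).symm
  have : IsScalarTower R S B := .of_algebraMap_eq fun _ ↦ rfl
  exact (pushPoint hn (tangentPush k R S B) { φ with commutes' := hφ }).commutes s

theorem chowRingPush_naturality {R₂ S₂ B₂ : Type u} [CommRing R₂] [Algebra k R₂] [CommRing S₂]
    [Algebra k S₂] [CommRing B₂] [Algebra.Smooth k R] [Algebra.Smooth k R₂]
    (hn : IsUnit (n.factorial : R)) (hn₂ : IsUnit (n.factorial : R₂))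
    (f : R →ₐ[k] S) (g : S →+* B) (φ : ChowRing k n R →+* B)
    (hφ : ∀ r, φ (algebraMap R _ r) = g (f r))
    (f₂ : R₂ →ₐ[k] S₂) (g₂ : S₂ →+* B₂) (φ₂ : ChowRing k n R₂ →+* B₂)
    (hφ₂ : ∀ r, φ₂ (algebraMap R₂ _ r) = g₂ (f₂ r))
    (a : R →ₐ[k] R₂) (ha : a.toRingHom.Etale) (b : S →ₐ[k] S₂) (hb : b.toRingHom.Etale)
    (β : B →+* B₂) (hab : ∀ r, f₂ (a r) = b (f r)) (hg : ∀ s, g₂ (b s) = β (g s))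
    (h : ∀ q, φ₂ (chowRingMap a ha q) = β (φ q)) (p : ChowRing k n S) :
    chowRingPush hn₂ f₂ g₂ φ₂ hφ₂ (chowRingMap b hb p) = β (chowRingPush hn f g φ hφ p) := by
  let _ := f.toRingHom.toAlgebra
  let _ := g.toAlgebra
  let _ := (g.comp f.toRingHom).toAlgebra
  let _ := f₂.toRingHom.toAlgebra
  let _ := g₂.toAlgebra
  let _ := (g₂.comp f₂.toRingHom).toAlgebra
  let _ := a.toRingHom.toAlgebra
  let _ := b.toRingHom.toAlgebra
  let _ := β.toAlgebra
  let _ := (b.toRingHom.comp f.toRingHom).toAlgebra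
  let _ := (β.comp (g.comp f.toRingHom)).toAlgebra
  let _ := (β.comp g).toAlgebra
  have : IsScalarTower k R S := .of_algebraMap_eq fun r ↦ (f.commutes r).symm
  have : IsScalarTower R S B := .of_algebraMap_eq fun _ ↦ rfl
  have : IsScalarTower k R₂ S₂ := .of_algebraMap_eq fun r ↦ (f₂.commutes r).symm
  have : IsScalarTower R₂ S₂ B₂ := .of_algebraMap_eq fun _ ↦ rfl
  have : IsScalarTower k R R₂ := .of_algebraMap_eq fun r ↦ (a.commutes r).symm
  have : IsScalarTower k S S₂ := .of_algebraMap_eq fun r ↦ (b.commutes r).symm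
  have : IsScalarTower R R₂ S₂ := .of_algebraMap_eq fun r ↦ (hab r).symm
  have : IsScalarTower R S S₂ := .of_algebraMap_eq fun r ↦ rfl
  have : IsScalarTower R B B₂ := .of_algebraMap_eq fun r ↦ rfl
  have : IsScalarTower S B B₂ := .of_algebraMap_eq fun r ↦ rfl
  have : IsScalarTower S S₂ B₂ := .of_algebraMap_eq fun r ↦ (hg r).symm
  have : IsScalarTower R R₂ B₂ := .of_algebraMap_eq fun r ↦ by
    change β (g (f r)) = g₂ (f₂ (a r))
    rw [hab, hg]
  have : Algebra.Etale R R₂ := ha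
  have : Algebra.Etale S S₂ := hb
  exact pushPoint_naturality hn hn₂ (tangentMap k R R₂) (tangentMap k S S₂) (tangentPush k R S B)
    (tangentPush k R₂ S₂ B₂) (tangentPush_naturality k) { φ with commutes' := hφ }
    { φ₂ with commutes' := hφ₂ } h p

end ChowRing

section Chow

variable {k : Type u} [CommRing k]

theorem le_preimage_top {X Y : Scheme.{u}} (f : X ⟶ Y) (U : X.Opens) : U ≤ f ⁻¹ᵁ ⊤ := le_top

/-- The `k`-algebra structure on the sections of a `k`-scheme. -/
instance sectionAlgebra (X : Over (Spec (.of k))) (U : X.left.Opens) : Algebra k Γ(X.left, U) :=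
  ((Scheme.ΓSpecIso (.of k)).inv ≫ X.hom.appLE ⊤ U (le_preimage_top _ _)).hom.toAlgebra

theorem algebraMap_section (X : Over (Spec (.of k))) (U : X.left.Opens) :
    algebraMap k Γ(X.left, U) =
      ((Scheme.ΓSpecIso (.of k)).inv ≫ X.hom.appLE ⊤ U (le_preimage_top _ _)).hom := rfl

theorem smooth_section (X : Over (Spec (.of k))) [Smooth X.hom] {U : X.left.Opens}
    (hU : IsAffineOpen U) : Algebra.Smooth k Γ(X.left, U) := by
  rw [← RingHom.smooth_algebraMap, algebraMap_section]
  have h1 := X.hom.smooth_appLE (isAffineOpen_top (Spec (.of k))) hU (le_preimage_top _ _)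
  rw [CommRingCat.hom_comp]
  exact RingHom.Smooth.stableUnderComposition _ _ (.of_bijective
    (ConcreteCategory.bijective_of_isIso (Scheme.ΓSpecIso (.of k)).inv)) h1

/-- Pullback of sections along a `k`-morphism, as a `k`-algebra map. -/
def pullbackSections {X' X : Over (Spec (.of k))} (χ : X' ⟶ X) (U : X.left.Opens)
    (U' : X'.left.Opens) (h : U' ≤ χ.left ⁻¹ᵁ U) : Γ(X.left, U) →ₐ[k] Γ(X'.left, U') where
  __ := (χ.left.appLE U U' h).hom
  commutes' c := by
    have h1 : X.hom.appLE ⊤ U (le_preimage_top _ _) ≫ χ.left.appLE U U' h = X'.hom.appLE ⊤ U' (le_preimage_top _ _) := by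
      rw [Scheme.Hom.appLE_comp_appLE]
      congr 1
      exact Over.w χ
    have h2 := congr((Scheme.ΓSpecIso (.of k)).inv ≫ $h1)
    rw [← Category.assoc] at h2
    exact congr($h2 c)

/-- Restriction of sections, as a `k`-algebra map. -/
def restrict (X : Over (Spec (.of k))) {U V : X.left.Opens} (h : V ≤ U) :
    Γ(X.left, U) →ₐ[k] Γ(X.left, V) where
  __ := (X.left.presheaf.map (homOfLE h).op).hom
  commutes' c := by
    have h1 : X.hom.appLE ⊤ U (le_preimage_top _ _) ≫ X.left.presheaf.map (homOfLE h).op =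
      X.hom.appLE ⊤ V (le_preimage_top _ _) := Scheme.Hom.appLE_map _ _ _
    have h2 := congr((Scheme.ΓSpecIso (.of k)).inv ≫ $h1)
    rw [← Category.assoc] at h2
    exact congr($h2 c)

theorem isLocalization_restrict (X : Over (Spec (.of k))) {U V : X.left.AffineZariskiSite}
    (h : V ≤ U) : ∃ f : Γ(X.left, U.toOpens), @IsLocalization.Away _ _ f Γ(X.left, V.toOpens) _
      (restrict X (Scheme.AffineZariskiSite.toOpens_mono h)).toRingHom.toAlgebra := by
  obtain ⟨f, hf⟩ := h
  exact ⟨f, U.2.isLocalization_of_eq_basicOpen f _ hf.symm⟩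

theorem etale_restrict (X : Over (Spec (.of k))) {U V : X.left.AffineZariskiSite} (h : V ≤ U) :
    (restrict X (Scheme.AffineZariskiSite.toOpens_mono h)).toRingHom.Etale := by
  obtain ⟨f, hf⟩ := isLocalization_restrict X h
  exact @Algebra.Etale.of_isLocalizationAway _ _ _ _
    (restrict X (Scheme.AffineZariskiSite.toOpens_mono h)).toRingHom.toAlgebra f hf

variable (n : ℕ) (X : Over (Spec (.of k)))

/-- The functions on `Chow^n(T^*_X / X)` over the affine open subset `U` of `X`. -/
abbrev chowSections (U : X.left.AffineZariskiSite) : CommRingCat.{u} :=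
  .of (ChowRing k n Γ(X.left, U.toOpens))

/-- The structure map of the algebra of functions on `Chow^n(T^*_X / X)` over `U`. -/
abbrev chowStructure (U : X.left.AffineZariskiSite) : Γ(X.left, U.toOpens) ⟶ chowSections n X U :=
  CommRingCat.ofHom (algebraMap Γ(X.left, U.toOpens) (ChowRing k n Γ(X.left, U.toOpens)))

/-- Restriction of functions on `Chow^n(T^*_X / X)` to a smaller (basic) affine open subset. -/
abbrev chowRestrict {U V : X.left.AffineZariskiSite} (h : V ≤ U) :
    chowSections n X U ⟶ chowSections n X V :=
  CommRingCat.ofHom (chowRingMap (restrict X (Scheme.AffineZariskiSite.toOpens_mono h))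
    (etale_restrict X h))

/-- The sheaf of functions on `Chow^n(T^*_X / X)`, on the affine opens of `X`. -/
def chowPresheaf : X.left.AffineZariskiSiteᵒᵖ ⥤ CommRingCat.{u} where
  obj U := chowSections n X U.unop
  map i := chowRestrict n X i.unop.le
  map_id U := by
    ext1
    exact chowRingMap_id _ (etale_restrict X le_rfl) fun r ↦
      congr($(X.left.presheaf.map_id (op U.unop.toOpens)) r)
  map_comp {U V W} i j := by
    ext1
    exact chowRingMap_comp _ (etale_restrict X i.unop.le) _ (etale_restrict X j.unop.le) _
      (etale_restrict X (j.unop.le.trans i.unop.le)) fun r ↦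
      congr($(X.left.presheaf.map_comp (homOfLE (Scheme.AffineZariskiSite.toOpens_mono i.unop.le)).op
        (homOfLE (Scheme.AffineZariskiSite.toOpens_mono j.unop.le)).op) r)

/-- The `O_X`-algebra structure on the sheaf of functions on `Chow^n(T^*_X / X)`. -/
def chowPresheafStructure :
    (Scheme.AffineZariskiSite.toOpensFunctor X.left).op ⋙ X.left.presheaf ⟶ chowPresheaf n X where
  app U := chowStructure n X U.unop
  naturality U V i := by
    ext r
    exact (chowRingMap_algebraMap _ (etale_restrict X i.unop.le) r).symm

theorem coequifibered_chowPresheafStructure [Smooth X.hom] :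
    (chowPresheafStructure n X).Coequifibered := by
  refine Scheme.AffineZariskiSite.coequifibered_iff_forall_isLocalizationAway.mpr fun U f ↦ ?_
  have := smooth_section X U.2
  exact isLocalization_chowRingMap _ (etale_restrict X (U.basicOpen_le f)) f
    (U.2.isLocalization_of_eq_basicOpen f _ rfl)

/-- The gluing datum of the relative spectrum of this quasi-coherent `O_X`-algebra. -/
def chowData [Smooth X.hom] :
    (Scheme.AffineZariskiSite.directedCover X.left).RelativeGluingData :=
  Scheme.AffineZariskiSite.relativeGluingData (coequifibered_chowPresheafStructure n X)

/-- The relative Chow scheme `Chow^n(T^*_X / X)` of `n` points on the cotangent bundle of a smooth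
`k`-scheme `X`, as a scheme over `X`: the relative spectrum of the `O_X`-algebra of `S_n`-invariants
of the `n`-th tensor power of the symmetric algebra of the tangent sheaf. -/
def Chow [Smooth X.hom] : Over X.left := Over.mk (chowData n X).toBase

end Chow

section Codifferential

/-- The ring map corresponding to a morphism to an affine scheme. -/
def coordHom {Z : Scheme.{u}} {A : CommRingCat.{u}} (m : Z ⟶ Spec A) : A ⟶ Γ(Z, ⊤) :=
  (Scheme.ΓSpecIso A).inv ≫ m.appTop

theorem coordHom_comp_map {Z : Scheme.{u}} {A A' : CommRingCat.{u}} (m : Z ⟶ Spec A) (h : A' ⟶ A) :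
    coordHom (m ≫ Spec.map h) = h ≫ coordHom m := by
  simp [coordHom]

theorem coordHom_precomp {Z Z' : Scheme.{u}} {A : CommRingCat.{u}} (z : Z' ⟶ Z) (m : Z ⟶ Spec A) :
    coordHom (z ≫ m) = coordHom m ≫ z.appTop := by
  simp [coordHom]

theorem toSpecΓ_map_coordHom {Z : Scheme.{u}} {A : CommRingCat.{u}} (m : Z ⟶ Spec A) :
    Z.toSpecΓ ≫ Spec.map (coordHom m) = m := by
  rw [coordHom, Spec.map_comp, ← Scheme.toSpecΓ_naturality_assoc]
  simp

variable {k : Type u} [Field k] [CharZero k] (n : ℕ)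

theorem isUnit_factorial (R : Type u) [CommRing R] [Algebra k R] : IsUnit (n.factorial : R) := by
  rw [← map_natCast (algebraMap k R)]
  exact (Nat.cast_ne_zero.mpr n.factorial_ne_zero).isUnit.map _

variable {X' X : Over (Spec (.of k))} (χ : X' ⟶ X) [Smooth X.hom]

variable {Z W : Scheme.{u}}

/-- The ring map underlying `localCodiff`. -/
def localCodiffRing {U : X.left.AffineZariskiSite} {U' : X'.left.AffineZariskiSite}
    (h : U'.toOpens ≤ χ.left ⁻¹ᵁ U.toOpens) (a : Z ⟶ Spec Γ(X'.left, U'.toOpens))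
    (b : Z ⟶ Spec (chowSections n X U))
    (hab : b ≫ Spec.map (chowStructure n X U) =
      a ≫ Spec.map (χ.left.appLE U.toOpens U'.toOpens h)) :
    chowSections n X' U' ⟶ Γ(Z, ⊤) :=
  haveI := smooth_section X U.2
  CommRingCat.ofHom (chowRingPush (isUnit_factorial (k := k) n Γ(X.left, U.toOpens))
    (pullbackSections χ U.toOpens U'.toOpens h) (coordHom a).hom (coordHom b).hom fun r ↦ by
      have := congrArg coordHom hab
      rw [coordHom_comp_map, coordHom_comp_map] at this
      exact congr($this r))

/-- For affine opens `U` of `X` and `U'` of `X'` with `χ(U') ⊆ U`, the codifferential on points with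
values in `Z`: a point `b` of `Chow^n(T^*_U / U)` over the image of a point `a` of `U'` goes to a point
of `Chow^n(T^*_{U'} / U')` over `a`. -/
def localCodiff {U : X.left.AffineZariskiSite} {U' : X'.left.AffineZariskiSite}
    (h : U'.toOpens ≤ χ.left ⁻¹ᵁ U.toOpens) (a : Z ⟶ Spec Γ(X'.left, U'.toOpens))
    (b : Z ⟶ Spec (chowSections n X U))
    (hab : b ≫ Spec.map (chowStructure n X U) =
      a ≫ Spec.map (χ.left.appLE U.toOpens U'.toOpens h)) :
    Z ⟶ Spec (chowSections n X' U') :=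
  Z.toSpecΓ ≫ Spec.map (localCodiffRing n χ h a b hab)

theorem localCodiff_structure {U : X.left.AffineZariskiSite} {U' : X'.left.AffineZariskiSite}
    (h : U'.toOpens ≤ χ.left ⁻¹ᵁ U.toOpens) (a : Z ⟶ Spec Γ(X'.left, U'.toOpens))
    (b : Z ⟶ Spec (chowSections n X U))
    (hab : b ≫ Spec.map (chowStructure n X U) =
      a ≫ Spec.map (χ.left.appLE U.toOpens U'.toOpens h)) :
    localCodiff n χ h a b hab ≫ Spec.map (chowStructure n X' U') = a := by
  have := smooth_section X U.2
  have key : chowStructure n X' U' ≫ localCodiffRing n χ h a b hab = coordHom a := by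
    ext s
    exact chowRingPush_algebraMap (isUnit_factorial (k := k) n Γ(X.left, U.toOpens)) _ _ _ _ s
  rw [localCodiff, Category.assoc, ← Spec.map_comp, key, toSpecΓ_map_coordHom]

theorem localCodiff_naturality {U V : X.left.AffineZariskiSite} {U' V' : X'.left.AffineZariskiSite}
    (hU : U'.toOpens ≤ χ.left ⁻¹ᵁ U.toOpens) (hV : V'.toOpens ≤ χ.left ⁻¹ᵁ V.toOpens)
    (i : V ≤ U) (i' : V' ≤ U') (z : W ⟶ Z)
    (a : Z ⟶ Spec Γ(X'.left, U'.toOpens)) (b : Z ⟶ Spec (chowSections n X U))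
    (hab : b ≫ Spec.map (chowStructure n X U) =
      a ≫ Spec.map (χ.left.appLE U.toOpens U'.toOpens hU))
    (a₂ : W ⟶ Spec Γ(X'.left, V'.toOpens)) (b₂ : W ⟶ Spec (chowSections n X V))
    (hab₂ : b₂ ≫ Spec.map (chowStructure n X V) =
      a₂ ≫ Spec.map (χ.left.appLE V.toOpens V'.toOpens hV))
    (ha : a₂ ≫ Spec.map (X'.left.presheaf.map
      (homOfLE (Scheme.AffineZariskiSite.toOpens_mono i')).op) = z ≫ a)
    (hb : b₂ ≫ Spec.map (chowRestrict n X i) = z ≫ b) :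
    localCodiff n χ hV a₂ b₂ hab₂ ≫ Spec.map (chowRestrict n X' i') =
      z ≫ localCodiff n χ hU a b hab := by
  have := smooth_section X U.2
  have := smooth_section X V.2
  have key : chowRestrict n X' i' ≫ localCodiffRing n χ hV a₂ b₂ hab₂ =
      localCodiffRing n χ hU a b hab ≫ z.appTop := by
    ext p
    refine chowRingPush_naturality (isUnit_factorial (k := k) n Γ(X.left, U.toOpens))
      (isUnit_factorial (k := k) n Γ(X.left, V.toOpens)) _ _ _ _ _ _ _ _
      (restrict X (Scheme.AffineZariskiSite.toOpens_mono i)) (etale_restrict X i)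
      (restrict X' (Scheme.AffineZariskiSite.toOpens_mono i')) (etale_restrict X' i')
      z.appTop.hom (fun r ↦ ?_) (fun s ↦ ?_) (fun q ↦ ?_) p
    · have h1 : X.left.presheaf.map (homOfLE (Scheme.AffineZariskiSite.toOpens_mono i)).op ≫
          χ.left.appLE V.toOpens V'.toOpens hV =
          χ.left.appLE U.toOpens U'.toOpens hU ≫ X'.left.presheaf.map
            (homOfLE (Scheme.AffineZariskiSite.toOpens_mono i')).op := by
        rw [Scheme.Hom.map_appLE, Scheme.Hom.appLE_map]
      exact congr($h1 r)
    · have := congrArg coordHom ha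
      rw [coordHom_comp_map, coordHom_precomp] at this
      exact congr($this s)
    · have := congrArg coordHom hb
      rw [coordHom_comp_map, coordHom_precomp] at this
      exact congr($this q)
  rw [localCodiff, localCodiff, Category.assoc, ← Spec.map_comp, key, Spec.map_comp,
    Scheme.toSpecΓ_naturality_assoc]

end Codifferential

section Cover

variable {X' X : Scheme.{u}} (f : X' ⟶ X)

/-- Pairs `(U', U)` of affine opens of `X'` and `X` with `f(U') ⊆ U`. -/
abbrev ChartPair : Type u :=
  { p : X'.AffineZariskiSite × X.AffineZariskiSite // p.1.toOpens ≤ f ⁻¹ᵁ p.2.toOpens }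

/-- The open cover of `X'` by the members `U'` of such pairs. -/
def chartCover : X'.OpenCover where
  I₀ := ChartPair f
  X p := p.1.1.toOpens
  f p := p.1.1.toOpens.ι
  mem₀ := by
    rw [Scheme.presieve₀_mem_precoverage_iff]
    refine ⟨fun x ↦ ?_, inferInstance⟩
    obtain ⟨_, ⟨U, hU, rfl⟩, hxU, -⟩ :=
      X.isBasis_affineOpens.exists_subset_of_mem_open (Set.mem_univ (f x)) isOpen_univ
    obtain ⟨_, ⟨U', hU', rfl⟩, hxU', hle⟩ :=
      X'.isBasis_affineOpens.exists_subset_of_mem_open (show x ∈ f ⁻¹ᵁ U from hxU) (f ⁻¹ᵁ U).2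
    exact ⟨⟨(⟨U', hU'⟩, ⟨U, hU⟩), hle⟩, ⟨x, hxU'⟩, rfl⟩

instance : Preorder (chartCover f).I₀ := inferInstanceAs (Preorder (ChartPair f))

theorem exists_chartPair_le (p q : ChartPair f) (x : X') (hp : x ∈ p.1.1.toOpens)
    (hq : x ∈ q.1.1.toOpens) : ∃ r : ChartPair f, r ≤ p ∧ r ≤ q ∧ x ∈ r.1.1.toOpens := by
  obtain ⟨⟨U', U⟩, hU⟩ := p
  obtain ⟨⟨V', V⟩, hV⟩ := q
  obtain ⟨r, s, hrs, hr⟩ := exists_basicOpen_le_affine_inter U.2 V.2 (f x) ⟨hU hp, hV hq⟩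
  obtain ⟨r', s', hrs', hr'⟩ := exists_basicOpen_le_affine_inter U'.2 V'.2 x ⟨hp, hq⟩
  have e1 : X'.basicOpen (r' * f.appLE U.toOpens U'.toOpens hU r) =
      X'.basicOpen r' ⊓ f ⁻¹ᵁ X.basicOpen r := by
    rw [X'.basicOpen_mul, Scheme.basicOpen_appLE, ← inf_assoc, inf_eq_left.mpr (X'.basicOpen_le r')]
  have e2 : X'.basicOpen (s' * f.appLE V.toOpens V'.toOpens hV s) =
      X'.basicOpen r' ⊓ f ⁻¹ᵁ X.basicOpen r := by
    rw [X'.basicOpen_mul, Scheme.basicOpen_appLE, ← inf_assoc, inf_eq_left.mpr (X'.basicOpen_le s'),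
      hrs, hrs']
  refine ⟨⟨(U'.basicOpen (r' * f.appLE U.toOpens U'.toOpens hU r), U.basicOpen r),
    e1.le.trans inf_le_right⟩, ⟨⟨_, rfl⟩, ⟨_, rfl⟩⟩, ⟨⟨_, e2.trans e1.symm⟩, ⟨_, hrs.symm⟩⟩, ?_⟩
  exact e1.ge ⟨hr', hr⟩

instance : (chartCover f).LocallyDirected where
  trans {i j} hij := X'.homOfLE (Scheme.AffineZariskiSite.toOpens_mono hij.le.1)
  trans_id i := X'.homOfLE_rfl _
  trans_comp hij hjk := (X'.homOfLE_homOfLE _ _).symm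
  w hij := X'.homOfLE_ι _
  directed {i j} x := by
    have hx : (pullback.fst ((chartCover f).f i) ((chartCover f).f j) x).1 =
        (pullback.snd ((chartCover f).f i) ((chartCover f).f j) x).1 :=
      congr($(pullback.condition (f := (chartCover f).f i) (g := (chartCover f).f j)) x)
    obtain ⟨r, hri, hrj, hr⟩ := exists_chartPair_le f i j
      (pullback.fst ((chartCover f).f i) ((chartCover f).f j) x).1
      (pullback.fst ((chartCover f).f i) ((chartCover f).f j) x).2
      (hx ▸ (pullback.snd ((chartCover f).f i) ((chartCover f).f j) x).2)
    refine ⟨r, homOfLE hri, homOfLE hrj, ⟨_, hr⟩, ?_⟩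
    apply (pullback.fst ((chartCover f).f i) ((chartCover f).f j) ≫
      (chartCover f).f i).isOpenEmbedding.injective
    have h1 (a : (chartCover f).X r ⟶ (chartCover f).X i) (b : (chartCover f).X r ⟶ (chartCover f).X j)
        (ha : a ≫ (chartCover f).f i = (chartCover f).f r) (hab) :
        pullback.lift a b hab ≫ pullback.fst ((chartCover f).f i) ((chartCover f).f j) ≫
          (chartCover f).f i = (chartCover f).f r := by
      rw [pullback.lift_fst_assoc, ha]
    exact congr($(h1 _ _ (X'.homOfLE_ι _) _) ⟨_, hr⟩)
  property_trans hij := inferInstanceAs (IsOpenImmersion (X'.homOfLE _))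

end Cover

section Charts

theorem map_cover_f {S : Scheme.{u}} {𝒰 : S.OpenCover} [Category 𝒰.I₀] [𝒰.LocallyDirected]
    [Small.{u} 𝒰.I₀] [Quiver.IsThin 𝒰.I₀] (d : 𝒰.RelativeGluingData) {i j : 𝒰.I₀} (h : i ⟶ j) :
    d.functor.map h ≫ d.cover.f j = d.cover.f i :=
  colimit.w d.functor h

theorem isPullback_cover_f {S : Scheme.{u}} {𝒰 : S.OpenCover} [Category 𝒰.I₀] [𝒰.LocallyDirected]
    [Small.{u} 𝒰.I₀] [Quiver.IsThin 𝒰.I₀] (d : 𝒰.RelativeGluingData) (i : 𝒰.I₀) :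
    IsPullback (d.natTrans.app i) (d.cover.f i) (𝒰.f i) d.toBase :=
  d.isPullback_natTrans_ι_toBase i

variable {k : Type u} [CommRing k] (n : ℕ) (X : Over (Spec (.of k))) [Smooth X.hom]

/-- The chart `Chow^n(T^*_U / U)` of `Chow^n(T^*_X / X)`. -/
def chowChart (U : X.left.AffineZariskiSite) : Spec (chowSections n X U) ⟶ (Chow n X).left :=
  (chowData n X).cover.f U

theorem chowRestrict_chowChart {U V : X.left.AffineZariskiSite} (h : V ≤ U) :
    Spec.map (chowRestrict n X h) ≫ chowChart n X U = chowChart n X V :=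
  map_cover_f (chowData n X) (homOfLE h)

theorem isPullback_chowChart (U : X.left.AffineZariskiSite) :
    IsPullback (Spec.map (chowStructure n X U)) (chowChart n X U) U.2.fromSpec (Chow n X).hom := by
  have h := isPullback_cover_f (chowData n X) U
  have h1 : (chowData n X).natTrans.app U =
      Spec.map (chowStructure n X U) ≫ U.2.isoSpec.inv := rfl
  refine IsPullback.of_iso h (Iso.refl _) U.2.isoSpec (Iso.refl _) (Iso.refl _) ?_ ?_ ?_ ?_
  · exact (congrArg (· ≫ U.2.isoSpec.hom) h1).trans ((Category.assoc _ _ _).trans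
      ((congrArg _ U.2.isoSpec.inv_hom_id).trans ((Category.comp_id _).trans
        (Category.id_comp _).symm)))
  · exact (Category.comp_id _).trans (Category.id_comp _).symm
  · exact (Category.comp_id _).trans U.2.isoSpec_hom_fromSpec.symm
  · exact (Category.comp_id _).trans (Category.id_comp _).symm

end Charts

section Codifferential

variable {k : Type u} [Field k] [CharZero k] (n : ℕ) {X' X : Over (Spec (.of k))} (χ : X' ⟶ X)
  [Smooth X.hom] [Smooth X'.hom]

/-- The base change `Chow^n(T^*_X / X) ×_X X'`. -/
abbrev chowPullback : Over X'.left := (Over.pullback χ.left).obj (Chow n X)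

/-- The cover of `Chow^n(T^*_X / X) ×_X X'` induced by `chartCover`. -/
abbrev chowPullbackCover : (chowPullback n χ).left.OpenCover :=
  (chartCover χ.left).pullback₁ (chowPullback n χ).hom

/-- The part of `Chow^n(T^*_X / X) ×_X X'` over the open `U'`. -/
abbrev chowPiece (i : ChartPair χ.left) : Scheme.{u} :=
  pullback (chowPullback n χ).hom i.1.1.toOpens.ι

/-- The inclusion of this part. -/
abbrev chowPieceι (i : ChartPair χ.left) : chowPiece n χ i ⟶ (chowPullback n χ).left :=
  pullback.fst _ _

/-- The projection to `U'`. -/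
def coverToBase (i : ChartPair χ.left) : chowPiece n χ i ⟶ Spec Γ(X'.left, i.1.1.toOpens) :=
  pullback.snd _ _ ≫ i.1.1.2.isoSpec.hom

theorem coverToBase_fromSpec (i : ChartPair χ.left) :
    coverToBase n χ i ≫ i.1.1.2.fromSpec = chowPieceι n χ i ≫ (chowPullback n χ).hom := by
  rw [coverToBase, Category.assoc, IsAffineOpen.isoSpec_hom_fromSpec]
  exact pullback.condition.symm

/-- The projection to `Chow^n(T^*_U / U)`. -/
def coverToChow (i : ChartPair χ.left) :
    chowPiece n χ i ⟶ Spec (chowSections n X i.1.2) :=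
  (isPullback_chowChart n X i.1.2).lift
    (coverToBase n χ i ≫ Spec.map (χ.left.appLE i.1.2.toOpens i.1.1.toOpens i.2))
    (chowPieceι n χ i ≫ pullback.fst (Chow n X).hom χ.left) (by
      rw [Category.assoc, IsAffineOpen.SpecMap_appLE_fromSpec _ i.1.2.2 i.1.1.2 i.2,
        ← Category.assoc, coverToBase_fromSpec, Category.assoc, Category.assoc]
      exact congrArg _ pullback.condition.symm)

theorem coverToChow_structure (i : ChartPair χ.left) :
    coverToChow n χ i ≫ Spec.map (chowStructure n X i.1.2) =
      coverToBase n χ i ≫ Spec.map (χ.left.appLE i.1.2.toOpens i.1.1.toOpens i.2) :=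
  (isPullback_chowChart n X i.1.2).lift_fst _ _ _

/-- The codifferential on this part. -/
def coverCodiff (i : ChartPair χ.left) : chowPiece n χ i ⟶ (Chow n X').left :=
  localCodiff n χ i.2 (coverToBase n χ i) (coverToChow n χ i)
    (coverToChow_structure n χ i) ≫ chowChart n X' i.1.1

theorem comp_coverCodiff {i j : ChartPair χ.left} (hle : i ≤ j)
    (t : chowPiece n χ i ⟶ chowPiece n χ j)
    (ht : t ≫ chowPieceι n χ j = chowPieceι n χ i) :
    t ≫ coverCodiff n χ j = coverCodiff n χ i := by
  have ha : coverToBase n χ i ≫ Spec.map (X'.left.presheaf.map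
      (homOfLE (Scheme.AffineZariskiSite.toOpens_mono hle.1)).op) = t ≫ coverToBase n χ j := by
    rw [← cancel_mono j.1.1.2.fromSpec, Category.assoc, Category.assoc,
      IsAffineOpen.map_fromSpec _ i.1.1.2, coverToBase_fromSpec, coverToBase_fromSpec, ← ht,
      Category.assoc]
  have hb : coverToChow n χ i ≫ Spec.map (chowRestrict n X hle.2) = t ≫ coverToChow n χ j := by
    apply (isPullback_chowChart n X j.1.2).hom_ext
    · have h1 : chowStructure n X j.1.2 ≫ chowRestrict n X hle.2 =
          X.left.presheaf.map (homOfLE (Scheme.AffineZariskiSite.toOpens_mono hle.2)).op ≫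
            chowStructure n X i.1.2 := by
        ext r
        exact congrArg Subtype.val (chowRingMap_algebraMap (n := n) _ (etale_restrict X hle.2) r)
      rw [Category.assoc, Category.assoc, coverToChow, coverToChow, IsPullback.lift_fst,
        ← Spec.map_comp, h1, Spec.map_comp, IsPullback.lift_fst_assoc, ← Category.assoc t, ← ha,
        Category.assoc, Category.assoc, ← Spec.map_comp, ← Spec.map_comp, Scheme.Hom.map_appLE,
        Scheme.Hom.appLE_map]
    · rw [Category.assoc, Category.assoc, coverToChow, coverToChow, IsPullback.lift_snd,
        chowRestrict_chowChart, IsPullback.lift_snd, ← Category.assoc, ht]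
  rw [coverCodiff, coverCodiff, ← chowRestrict_chowChart n X' hle.1, ← Category.assoc,
    ← Category.assoc]
  congr 1
  exact (localCodiff_naturality n χ j.2 i.2 hle.2 hle.1 t _ _ _ _ _ _ ha hb).symm

theorem coverCodiff_hom (i : ChartPair χ.left) : coverCodiff n χ i ≫ (Chow n X').hom =
    chowPieceι n χ i ≫ (chowPullback n χ).hom := by
  rw [coverCodiff, Category.assoc, ← (isPullback_chowChart n X' i.1.1).w, ← Category.assoc,
    localCodiff_structure, coverToBase_fromSpec]

/-- The codifferential `Chow^n(T^*_X / X) ×_X X' → Chow^n(T^*_{X'} / X')` over `X'`, induced by the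
pullback of differential forms `T^*_X ×_X X' → T^*_{X'}` along `χ : X' → X`. -/
def codifferential : chowPullback n χ ⟶ Chow n X' :=
  (chowPullbackCover n χ).glueMorphismsOverOfLocallyDirected (coverCodiff n χ)
    (fun hij ↦ comp_coverCodiff n χ (leOfHom (X := ChartPair χ.left) hij) _
      ((chowPullbackCover n χ).trans_map hij)) (coverCodiff_hom n χ)

end Codifferential

section Functors

variable {k : Type u} [Field k] (n : ℕ)

/-- The space of spectral data `A_X = Sect(X, Chow^n(T^*_X / X))`, as a functor on `k`-schemes: its
`T`-points are the `X`-morphisms `T ×_k X → Chow^n(T^*_X / X)`, that is, the sections over `T ×_k X`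
of the base change of `Chow^n(T^*_X / X)`. This base change is the relative Chow scheme of the
relative cotangent bundle of `T ×_k X` over `T`. -/
def spectralData (X : Over (Spec (.of k))) [Smooth X.hom] : (Over (Spec (.of k)))ᵒᵖ ⥤ Type u :=
  (Over.pullback X.hom).op ⋙ yoneda.obj (Chow n X)

/-- The morphism `T ×_k X' → T ×_k X`. -/
def baseChangeMap {X' X : Over (Spec (.of k))} (χ : X' ⟶ X) (T : Over (Spec (.of k))) :
    ((Over.pullback X'.hom).obj T).left ⟶ ((Over.pullback X.hom).obj T).left :=
  pullback.lift (pullback.fst T.hom X'.hom) (pullback.snd T.hom X'.hom ≫ χ.left) (by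
    rw [Category.assoc, Over.w χ, pullback.condition])

/-- The section over `T ×_k X'` of the base change of `Chow^n(T^*_X / X)` given by pulling back `a`. -/
def pullbackSpectralData {X' X : Over (Spec (.of k))} (χ : X' ⟶ X) [Smooth X.hom]
    {T : Over (Spec (.of k))} (a : (Over.pullback X.hom).obj T ⟶ Chow n X) :
    (Over.pullback X'.hom).obj T ⟶ chowPullback n χ :=
  Over.homMk (pullback.lift (baseChangeMap χ T ≫ a.left) ((Over.pullback X'.hom).obj T).hom (by
    rw [Category.assoc, Over.w a]
    exact pullback.lift_snd _ _ _)) (pullback.lift_snd _ _ _)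

theorem map_baseChangeMap {X' X : Over (Spec (.of k))} (χ : X' ⟶ X)
    {T T' : Over (Spec (.of k))} (t : T ⟶ T') :
    ((Over.pullback X'.hom).map t).left ≫ baseChangeMap χ T' =
      baseChangeMap χ T ≫ ((Over.pullback X.hom).map t).left := by
  apply pullback.hom_ext
  · rw [Category.assoc, Category.assoc]
    refine (congrArg _ (pullback.lift_fst _ _ _)).trans (((pullback.lift_fst _ _ _)).trans ?_)
    refine Eq.trans ?_ (congrArg _ (pullback.lift_fst _ _ _)).symm
    refine Eq.trans ?_ (Category.assoc _ _ _)
    exact (congrArg (· ≫ t.left) (pullback.lift_fst _ _ _)).symm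
  · rw [Category.assoc, Category.assoc]
    refine (congrArg _ (pullback.lift_snd _ _ _)).trans ?_
    refine Eq.trans ?_ (congrArg _ (pullback.lift_snd _ _ _)).symm
    refine (Category.assoc _ _ _).symm.trans (Eq.trans ?_ (pullback.lift_snd _ _ _).symm)
    exact congrArg (· ≫ χ.left) (pullback.lift_snd _ _ _)

theorem map_pullbackSpectralData {X' X : Over (Spec (.of k))} (χ : X' ⟶ X) [Smooth X.hom]
    {T T' : Over (Spec (.of k))} (t : T ⟶ T') (a : (Over.pullback X.hom).obj T' ⟶ Chow n X) :
    pullbackSpectralData n χ ((Over.pullback X.hom).map t ≫ a) =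
      (Over.pullback X'.hom).map t ≫ pullbackSpectralData n χ a := by
  ext1
  apply pullback.hom_ext
  · simp only [pullbackSpectralData, Over.homMk_left, Over.comp_left, Category.assoc,
      pullback.lift_fst]
    rw [← Category.assoc, ← Category.assoc, map_baseChangeMap]
  · simp only [pullbackSpectralData, Over.homMk_left, Over.comp_left, Category.assoc,
      pullback.lift_snd]
    exact (Over.w ((Over.pullback X'.hom).map t)).symm

variable [CharZero k]

/-- The natural morphism `A_X → A_{X'}`: pull back a section along `T ×_k X' → T ×_k X`, then apply the
codifferential. -/
def spectralDataMap {X' X : Over (Spec (.of k))} (χ : X' ⟶ X) [Smooth X.hom] [Smooth X'.hom] :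
    spectralData n X ⟶ spectralData n X' where
  app T := ↾fun a : (Over.pullback X.hom).obj T.unop ⟶ Chow n X ↦
    (pullbackSpectralData n χ a ≫ codifferential n χ :
      (Over.pullback X'.hom).obj T.unop ⟶ Chow n X')
  naturality _ _ t := by
    ext a
    exact (congrArg (· ≫ codifferential n χ) (map_pullbackSpectralData n χ t.unop a)).trans
      (Category.assoc _ _ _)

/-- A morphism is birational if it restricts to an isomorphism from a dense open subscheme of the source
onto a dense open subscheme of the target. -/
def IsBirationalMorphism {X' X : Scheme.{u}} (f : X' ⟶ X) : Prop :=
  ∃ φ : Scheme.PartialIso X' X, φ.iso.hom ≫ φ.target.ι = φ.source.ι ≫ f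

end Functors

end SpectralData

end

/-! Let `W = isoLocus χ` be the largest open subset of `X` over which `χ` is an isomorphism. The
valuative criterion of properness, applied to the inverse of `χ` at the generic point, shows that
`W` contains every point of `X` whose local ring is a valuation ring (`mem_isoLocus`). As `X` is
smooth over a field, it is normal and locally Noetherian, so a rational function that is not regular
has a pole at such a point (`exists_prime_valuationRing`). Hence functions extend from `W` to `X`.

Every `T` is flat over the field `k`, so `T ×_k X → X` is flat, and functions also extend from the
part over `W` to all of `T ×_k X`, even when `T` is not reduced (`bijective_app_of_flat`). The Chow
scheme is affine over `X`; its sections are given by functions, and they extend in the same way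
(`exists_extension`).

Over `χ⁻¹(W)` the codifferential is an isomorphism (`mem_isoLocus_codifferential`). For
surjectivity, restrict spectral data `b` on `X'` to `χ⁻¹(W)`, invert the codifferential there, and
extend the resulting map to the Chow scheme of `X` over all of `T ×_k X`. The image of this
extension equals `b` over `χ⁻¹(W)`. It equals `b` everywhere, because the Chow scheme of `X'` is
separated over `X'` and `χ⁻¹(W)` stays scheme-theoretically dense after the flat base change. The
same density argument gives injectivity. No extension theorem is needed on `X'`. -/

noncomputable section

set_option linter.unusedSectionVars false

namespace SpectralData

/-! ### Smooth domains over a field are normal -/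

section Normality

/-- An étale algebra over a normal domain which is itself a domain is normal. -/
theorem isIntegrallyClosed_of_etale (P L : Type u) [CommRing P] [IsDomain P] [IsIntegrallyClosed P]
    [CommRing L] [IsDomain L] [Algebra P L] [Algebra.Etale P L] : IsIntegrallyClosed L := by
  let F := FractionRing P
  have hinj : Function.Injective (algebraMap P L) := by
    rw [injective_iff_map_eq_zero]
    intro p hp
    by_contra h0
    -- Flatness: a nonzero element of the domain `P` acts injectively on `L`, so it cannot map to
    -- zero.
    have h1 : IsSMulRegular L p := by
      have := Module.Flat.isSMulRegular_of_isRegular (M := L)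
        (isRegular_iff_ne_zero.mpr h0 : IsRegular p)
      exact this
    have h2 : (1 : L) = 0 := h1 (by simp [Algebra.smul_def, hp])
    exact one_ne_zero h2
  have hM : Algebra.algebraMapSubmonoid L (nonZeroDivisors P) ≤ nonZeroDivisors L := by
    rintro _ ⟨p, hp, rfl⟩
    exact mem_nonZeroDivisors_of_ne_zero
      ((map_ne_zero_iff _ hinj).mpr (nonZeroDivisors.ne_zero hp))
  have hloc : IsLocalization (Algebra.algebraMapSubmonoid L (nonZeroDivisors P)) (L ⊗[P] F) :=
    inferInstance
  have hdom : IsDomain (L ⊗[P] F) := IsLocalization.isDomain_of_le_nonZeroDivisors _ hM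
  -- An étale algebra over the field `F` is finite over it, and a domain that is integral over a
  -- field is a field. So `L ⊗ F`, a localization of `L`, is its fraction field.
  have hfield : IsField (L ⊗[P] F) := by
    have h1 : Module.Finite F (F ⊗[P] L) := Algebra.FormallyUnramified.finite_of_free _ _
    let e : F ⊗[P] L ≃+* L ⊗[P] F := (Algebra.TensorProduct.comm P F L).toRingEquiv
    have : IsDomain (F ⊗[P] L) := e.toMulEquiv.isDomain _
    exact MulEquiv.isField (isField_of_isIntegral_of_isField' (R := F) (Field.toIsField F))
      e.symm.toMulEquiv
  have hfrac : IsFractionRing L (L ⊗[P] F) := by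
    let _ := hfield.toField
    exact IsFractionRing.of_field _ _ fun z ↦ by
      obtain ⟨⟨a, s⟩, h⟩ := IsLocalization.surj
        (Algebra.algebraMapSubmonoid L (nonZeroDivisors P)) z
      have hs : algebraMap L (L ⊗[P] F) s ≠ 0 := (IsLocalization.map_units _ s).ne_zero
      exact ⟨a, s, by rw [eq_div_iff hs]; exact h⟩
  rw [isIntegrallyClosed_iff (L ⊗[P] F)]
  intro x hx
  -- Integral closure commutes with smooth base change, so `x` comes from `L ⊗ P̃`, where `P̃` is
  -- the integral closure of `P` in `F`. Since `P` is normal, `P̃` is `P` and this tensor product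
  -- has image `L`.
  obtain ⟨y, hy⟩ := (TensorProduct.toIntegralClosure_bijective_of_smooth
    (R := P) (S := L) (B := F)).2 ⟨x, hx⟩
  have key (z : L ⊗[P] integralClosure P F) : ∃ l, algebraMap L (L ⊗[P] F) l =
      (TensorProduct.toIntegralClosure P L F z : L ⊗[P] F) := by
    induction z with
    | zero => exact ⟨0, by simp⟩
    | add a b ha hb =>
      obtain ⟨a', ha⟩ := ha
      obtain ⟨b', hb⟩ := hb
      exact ⟨a' + b', by simp [ha, hb]⟩
    | tmul l b =>
      obtain ⟨c, hc⟩ := (isIntegrallyClosed_iff F).mp ‹IsIntegrallyClosed P› b.2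
      refine ⟨algebraMap P L c * l, ?_⟩
      change (algebraMap P L c * l) ⊗ₜ[P] (1 : F) = l ⊗ₜ[P] (b : F)
      rw [← hc, ← Algebra.smul_def, TensorProduct.smul_tmul, Algebra.smul_def, mul_one]
  obtain ⟨l, hl⟩ := key y
  exact ⟨l, by rw [hl, hy]⟩

/-- A smooth algebra over a field which is a domain is normal. -/
theorem isIntegrallyClosed_of_smooth (k A : Type u) [Field k] [CommRing A] [IsDomain A]
    [Algebra k A] [Algebra.Smooth k A] : IsIntegrallyClosed A := by
  refine IsIntegrallyClosed.of_localization_maximal fun p _ _ ↦ ?_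
  -- Near `p` the algebra is étale over a polynomial ring, which is a unique factorization domain
  -- and hence normal.
  obtain ⟨f, hf, n, _, _, _⟩ := Algebra.IsSmoothAt.exists_isStandardEtale_mvPolynomial
    (R := k) (p := p)
  have hf0 : Submonoid.powers f ≤ nonZeroDivisors A := powers_le_nonZeroDivisors_of_noZeroDivisors
    (by rintro rfl; exact hf (zero_mem p))
  have : IsDomain (Localization.Away f) := IsLocalization.isDomain_localization hf0
  have : Algebra.Etale (MvPolynomial (Fin n) k) (Localization.Away f) := inferInstance
  have hn : IsIntegrallyClosed (Localization.Away f) :=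
    isIntegrallyClosed_of_etale (MvPolynomial (Fin n) k) _
  have hle : Submonoid.powers f ≤ p.primeCompl := Submonoid.powers_le.mpr hf
  let _ := IsLocalization.localizationAlgebraOfSubmonoidLe (Localization.Away f)
    (Localization.AtPrime p) (Submonoid.powers f) p.primeCompl hle
  have := IsLocalization.localization_isScalarTower_of_submonoid_le (Localization.Away f)
    (Localization.AtPrime p) (Submonoid.powers f) p.primeCompl hle
  have := IsLocalization.isLocalization_of_submonoid_le (Localization.Away f)
    (Localization.AtPrime p) (Submonoid.powers f) p.primeCompl hle
  refine isIntegrallyClosed_of_isLocalization (R := Localization.Away f) _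
    (p.primeCompl.map (algebraMap A (Localization.Away f))) ?_
  rintro _ ⟨a, ha, rfl⟩
  refine mem_nonZeroDivisors_of_ne_zero ((map_ne_zero_iff _
    (IsLocalization.injective _ hf0)).mpr ?_)
  rintro rfl
  exact ha (zero_mem p)

end Normality

/-! ### Poles of rational functions on normal Noetherian domains -/

section Hartogs

/-- An element of the fraction field of a normal noetherian domain which is not in the ring has a
pole at a prime where the local ring is a valuation ring. -/
theorem exists_prime_valuationRing {A K : Type u} [CommRing A] [IsDomain A] [IsNoetherianRing A]
    [IsIntegrallyClosed A] [Field K] [Algebra A K] [IsFractionRing A K] (x : K)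
    (hx : x ∉ (algebraMap A K).range) :
    ∃ P : Ideal A, ∃ _ : P.IsPrime, (∀ a s : A, x * algebraMap A K s = algebraMap A K a → s ∈ P) ∧
      ∀ (R : Type u) [CommRing R] [IsDomain R] [Algebra A R] [IsLocalization.AtPrime R P],
        ValuationRing R := by
  obtain ⟨a, b, hb, rfl⟩ := IsFractionRing.div_surjective (A := A) x
  have hb0 : b ≠ 0 := nonZeroDivisors.ne_zero hb
  have hb1 : algebraMap A K b ≠ 0 := by simpa using hb0
  let M := A ⧸ Ideal.span {b}
  have ha : (Ideal.Quotient.mk (Ideal.span {b}) a : M) ≠ 0 := by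
    rw [Ne, Ideal.Quotient.eq_zero_iff_mem, Ideal.mem_span_singleton]
    rintro ⟨c, rfl⟩
    exact hx ⟨c, by rw [map_mul, mul_div_cancel_left₀ _ hb1]⟩
  -- The denominators of `a / b` form the annihilator of the class of `a` in `A / b`. `P` is an
  -- associated prime containing it, and `y` is a class with annihilator `P`.
  obtain ⟨P, hP, hle⟩ := exists_le_isAssociatedPrime_of_isNoetherianRing A _ ha
  obtain ⟨hprime, y', hy'⟩ := (isAssociatedPrime_iff).mp hP
  obtain ⟨y, rfl⟩ := Ideal.Quotient.mk_surjective y'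
  have hmem (c z : A) : c ∈ (⊥ : Submodule A M).colon {Ideal.Quotient.mk (Ideal.span {b}) z} ↔
      b ∣ c * z := by
    rw [Submodule.mem_colon_singleton, Submodule.mem_bot, ← Ideal.mem_span_singleton,
      ← Ideal.Quotient.eq_zero_iff_mem, map_mul]
    rfl
  have hPmem (c : A) : c ∈ P ↔ b ∣ c * y := by rw [hy', hmem]
  refine ⟨P, hprime, fun c s h ↦ hle ((hmem _ _).mpr ⟨c, ?_⟩), ?_⟩
  · apply IsFractionRing.injective A K
    rw [div_mul_eq_mul_div, div_eq_iff hb1, ← map_mul, ← map_mul] at h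
    rw [mul_comm s a, IsFractionRing.injective A K h, mul_comm]
  intro R _ _ _ _
  have hbP : b ∈ P := (hPmem b).mpr ⟨y, rfl⟩
  -- Multiplication by `y / b` sends `P` into `A`. If it sent `P` into `P`, then `y / b` would be
  -- integral by Cayley–Hamilton, hence in `A`, and `b ∣ y` would force `1 ∈ P`. So some `t ∈ P`
  -- goes to an element `u` outside `P`.
  obtain ⟨t, ht, u, hu, htu⟩ : ∃ t ∈ P, ∃ u ∉ P, t * y = b * u := by
    by_contra! hcon
    have hint : IsIntegral A (algebraMap A K y / algebraMap A K b) := by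
      refine isIntegral_of_smul_mem_submodule (Submodule.map (Algebra.linearMap A K) P)
        ?_ ((IsNoetherian.noetherian P).map _) _ ?_
      · intro h
        have : algebraMap A K b ∈ Submodule.map (Algebra.linearMap A K) P := ⟨b, hbP, rfl⟩
        rw [h] at this
        exact hb1 this
      · rintro _ ⟨t, ht, rfl⟩
        obtain ⟨u, hu⟩ := (hPmem t).mp ht
        refine ⟨u, by_contra fun h ↦ hcon t ht u h hu, ?_⟩
        rw [Algebra.linearMap_apply, Algebra.linearMap_apply, smul_eq_mul, div_mul_eq_mul_div,
          eq_div_iff hb1, ← map_mul, ← map_mul, mul_comm u, ← hu, mul_comm]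
    obtain ⟨c, hc⟩ := IsIntegrallyClosed.isIntegral_iff.mp hint
    apply hprime.ne_top
    rw [Ideal.eq_top_iff_one, hPmem, one_mul]
    refine ⟨c, IsFractionRing.injective A K ?_⟩
    rw [map_mul, hc, mul_div_cancel₀ _ hb1]
  have hnoeth : IsNoetherianRing R := IsLocalization.isNoetherianRing P.primeCompl R inferInstance
  have hlocal : IsLocalRing R := IsLocalization.AtPrime.isLocalRing R P
  -- A Noetherian local domain with principal maximal ideal is a valuation ring. The generator is
  -- `t`: for `c ∈ P` with `c y = b d` one gets `c u = t d`, and `u` is a unit in the localization.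
  refine ((tfae_of_isNoetherianRing_of_isLocalRing_of_isDomain R).out 4 1).mp ?_
  refine ⟨⟨algebraMap A R t, ?_⟩⟩
  rw [← IsLocalization.AtPrime.map_eq_maximalIdeal P R]
  refine le_antisymm (Ideal.map_le_iff_le_comap.mpr fun c hc ↦ ?_)
    ((Ideal.span_singleton_le_iff_mem _).mpr (Ideal.mem_map_of_mem _ ht))
  obtain ⟨d, hd⟩ := (hPmem c).mp hc
  have hcd : c * u = t * d := by
    apply mul_left_cancel₀ hb0
    calc b * (c * u) = c * (b * u) := by ring
      _ = t * (c * y) := by rw [← htu]; ring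
      _ = b * (t * d) := by rw [hd]; ring
  have hunit : IsUnit (algebraMap A R u) := IsLocalization.map_units R (⟨u, hu⟩ : P.primeCompl)
  refine Ideal.mem_span_singleton.mpr ((hunit.dvd_mul_right).mp ⟨algebraMap A R d, ?_⟩)
  rw [← map_mul, hcd, map_mul]

end Hartogs

/-! ### Uniqueness and extension of morphisms to affine schemes over a base -/

section Extension

/-- Morphisms to a separated scheme which agree after composition with a scheme-theoretically
dominant morphism are equal. -/
theorem ext_of_isSchemeTheoreticallyDominant {W X Y Z : Scheme.{u}} {f g : X ⟶ Y}
    (s : Y ⟶ Z) [IsSeparated s] (h : f ≫ s = g ≫ s)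
    (i : W ⟶ X) [IsSchemeTheoreticallyDominant i] (hi : i ≫ f = i ≫ g) : f = g := by
  let f' : Over.mk (f ≫ s) ⟶ Over.mk s := Over.homMk f
  let g' : Over.mk (f ≫ s) ⟶ Over.mk s := Over.homMk g
  let i' : Over.mk (i ≫ f ≫ s) ⟶ Over.mk (f ≫ s) := Over.homMk i
  have : IsSeparated (Over.mk s).hom := ‹_›
  have hc : IsClosedImmersion (equalizer.ι f' g').left := inferInstance
  have hw : i' ≫ f' = i' ≫ g' := by ext1; exact hi
  have hlift : (equalizer.lift i' hw).left ≫ (equalizer.ι f' g').left = i := by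
    rw [← Over.comp_left, equalizer.lift_ι]; rfl
  -- The equalizer is closed by separatedness, and `i` factors through it. Its ideal therefore lies
  -- in the kernel of `i`, which is zero.
  have hiso : IsIso (equalizer.ι f' g').left := by
    rw [IsClosedImmersion.isIso_iff_ker_eq_bot, eq_bot_iff, ← i.ker_eq_bot, ← hlift]
    exact Scheme.Hom.le_ker_comp _ _
  rw [← cancel_epi (equalizer.ι f' g').left]
  exact congr($(equalizer.condition f' g').left)

/-- Let `f : Y₀ → Y` be such that `𝒪_Y → f_* 𝒪_{Y₀}` is bijective on the members of an affine open
cover. Then a `Y`-morphism from `Y₀` to an affine `Y`-scheme extends to a section. -/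
theorem exists_section_of_bijective_app {Y₀ Y A : Scheme.{u}} (f : Y₀ ⟶ Y) [QuasiCompact f]
    (h : A ⟶ Y) [IsAffineHom h] (c : Y₀ ⟶ A) (hc : c ≫ h = f)
    (H : ∀ y : Y, ∃ V : Y.Opens, IsAffineOpen V ∧ y ∈ V ∧ Function.Bijective (f.app V)) :
    ∃ a : Y ⟶ A, f ≫ a = c ∧ a ≫ h = 𝟙 Y := by
  subst hc
  have : QuasiCompact c := .of_comp c h
  let m := c.imageι ≫ h
  have hm : c.toImage ≫ m = c ≫ h := by
    rw [← Category.assoc, Scheme.Hom.toImage_imageι]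
  -- The section is found by showing that the scheme-theoretic image of `c` maps isomorphically to
  -- `Y`. This map is affine, so functions on the `V y` suffice.
  have : IsIso m := by
    choose V hV hmem hb using H
    refine (IsZariskiLocalAtTarget.iff_of_iSup_eq_top (P := MorphismProperty.isomorphisms Scheme)
      V ?_).mpr fun y ↦ ?_
    · exact eq_top_iff.mpr fun y _ ↦ TopologicalSpace.Opens.mem_iSup.mpr ⟨y, hmem y⟩
    rw [MorphismProperty.isomorphisms.iff, isIso_morphismRestrict_iff_isIso_app _ (hV y),
      ConcreteCategory.isIso_iff_bijective]
    have e := hb y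
    rw [← hm, Scheme.Hom.comp_app] at e
    have hinj : Function.Injective (c.toImage.app (m ⁻¹ᵁ V y)) :=
      c.toImage_app_injective ⟨h ⁻¹ᵁ V y, (hV y).preimage h⟩
    -- The bijection from functions on `V y` to functions on its preimage in `Y₀` factors through
    -- functions on the image, and the second factor is injective. Hence both factors are bijective.
    refine ⟨Function.Injective.of_comp (f := c.toImage.app (m ⁻¹ᵁ V y)) e.1, fun z ↦ ?_⟩
    obtain ⟨v, hv⟩ := e.2 (c.toImage.app (m ⁻¹ᵁ V y) z)
    exact ⟨v, hinj hv⟩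
  refine ⟨inv m ≫ c.imageι, ?_, ?_⟩
  · rw [← hm, Category.assoc, IsIso.hom_inv_id_assoc, Scheme.Hom.toImage_imageι]
  · rw [Category.assoc, IsIso.inv_hom_id]

/-- Let `w : W → X` be a quasi-compact, quasi-separated morphism with `𝒪_X → w_* 𝒪_W` bijective on
affine opens. The same holds after flat base change, on the members of an affine open cover. -/
theorem bijective_app_of_flat {W X Y Y₀ : Scheme.{u}} {w : W ⟶ X} {g : Y ⟶ X} {q : Y₀ ⟶ W}
    {f : Y₀ ⟶ Y} (H : IsPullback q f w g) [QuasiCompact w] [QuasiSeparated w] [Flat g]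
    (hw : ∀ U : X.Opens, IsAffineOpen U → Function.Bijective (w.app U)) (y : Y) :
    ∃ V : Y.Opens, IsAffineOpen V ∧ y ∈ V ∧ Function.Bijective (f.app V) := by
  obtain ⟨_, ⟨U, hU, rfl⟩, hyU, -⟩ :=
    X.isBasis_affineOpens.exists_subset_of_mem_open (Set.mem_univ (g y)) isOpen_univ
  obtain ⟨_, ⟨V, hV, rfl⟩, hyV, hVU⟩ :=
    Y.isBasis_affineOpens.exists_subset_of_mem_open (show y ∈ g ⁻¹ᵁ U from hyU) (g ⁻¹ᵁ U).2
  refine ⟨V, hV, hyV, ?_⟩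
  have hY : f ⁻¹ᵁ V = q ⁻¹ᵁ (w ⁻¹ᵁ U) ⊓ f ⁻¹ᵁ V := by
    refine (inf_eq_right.mpr ?_).symm
    rw [← Scheme.Hom.comp_preimage, H.w, Scheme.Hom.comp_preimage]
    exact fun x hx ↦ hVU hx
  -- Flat base change: the functions on `f⁻¹(V)` are `Γ(W, w⁻¹(U)) ⊗ Γ(Y, V)` over `Γ(X, U)`. The
  -- first factor is `Γ(X, U)` itself by hypothesis.
  have h1 := isIso_pushoutSection_of_isQuasiSeparated_of_flat_right H (US := U) (UT := V)
    (UX := w ⁻¹ᵁ U) (UY := f ⁻¹ᵁ V) hVU le_rfl hY hU hV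
    (w.isCompact_preimage hU.isCompact) (w.isQuasiSeparated_preimage hU.isQuasiSeparated)
  replace h1 := (isIso_pushoutSection_iff H hVU le_rfl hY).mp h1
  have h2 : IsIso (w.appLE U (w ⁻¹ᵁ U) le_rfl) := by
    rw [← Scheme.Hom.app_eq_appLE, ConcreteCategory.isIso_iff_bijective]
    exact hw U hU
  have h3 : IsIso (f.appLE V (f ⁻¹ᵁ V) le_rfl) := h1.isIso_inr_of_isIso
  rwa [← Scheme.Hom.app_eq_appLE, ConcreteCategory.isIso_iff_bijective] at h3

/-- Let `w : W → X` be a quasi-compact, quasi-separated morphism with `𝒪_X → w_* 𝒪_W` bijective on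
affine opens. After flat base change `Y → X`, every morphism `W ×_X Y → C` to an affine `X`-scheme `C`
extends to `Y`. -/
theorem exists_extension {W X Y Y₀ C : Scheme.{u}} {w : W ⟶ X} {g : Y ⟶ X} {q : Y₀ ⟶ W}
    {f : Y₀ ⟶ Y} (H : IsPullback q f w g) [QuasiCompact w] [QuasiSeparated w] [Flat g]
    (hw : ∀ U : X.Opens, IsAffineOpen U → Function.Bijective (w.app U))
    (h : C ⟶ X) [IsAffineHom h] (c : Y₀ ⟶ C) (hc : c ≫ h = f ≫ g) :
    ∃ a : Y ⟶ C, f ≫ a = c ∧ a ≫ h = g := by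
  have : QuasiCompact f := MorphismProperty.of_isPullback H ‹QuasiCompact w›
  have : IsAffineHom (pullback.snd h g) := 
    isAffineHom_isStableUnderBaseChange.of_isPullback (IsPullback.of_hasPullback h g) ‹_›
  -- A morphism from `Y` to `C` over `X` is a section of `C ×_X Y → Y`, which is again affine.
  obtain ⟨a, ha, ha'⟩ := exists_section_of_bijective_app f (pullback.snd h g)
    (pullback.lift c f hc) (pullback.lift_snd _ _ _) (bijective_app_of_flat H hw)
  refine ⟨a ≫ pullback.fst h g, ?_, ?_⟩
  · rw [← Category.assoc, ha, pullback.lift_fst]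
  · rw [Category.assoc, pullback.condition, ← Category.assoc, ha', Category.id_comp]

end Extension

/-! ### The open set over which a proper birational morphism is an isomorphism -/

section Birational

/-- Restriction of sections is bijective on a normal noetherian affine open `U` if the smaller open
contains all points of `U` whose local ring is a valuation ring. -/
theorem bijective_restrict_of_forall_valuationRing {X : Scheme.{u}} [IsIntegral X] {U V : X.Opens}
    (hU : IsAffineOpen U) [IsNoetherianRing Γ(X, U)]
    (hn : Nonempty U → IsIntegrallyClosed Γ(X, U)) (hVU : V ≤ U)
    (hV : ∀ x ∈ U, ValuationRing (X.presheaf.stalk x) → x ∈ V) :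
    Function.Bijective (X.presheaf.map (homOfLE hVU).op) := by
  rcases isEmpty_or_nonempty U with hempty | hne
  · have h0 : U = ⊥ := by
      ext x; exact ⟨fun h ↦ (hempty.false ⟨x, h⟩).elim, fun h ↦ h.elim⟩
    obtain rfl : V = U := le_antisymm hVU (h0 ▸ bot_le)
    have : (homOfLE hVU) = 𝟙 _ := rfl
    rw [this, op_id, CategoryTheory.Functor.map_id]
    exact Function.bijective_id
  have := hn hne
  have hgenU : genericPoint X ∈ U :=
    ((genericPoint_spec X).mem_open_set_iff U.isOpen).mpr (by simpa using hne)
  -- The local ring at the generic point is a field, hence a valuation ring.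
  have hgen : genericPoint X ∈ V := hV _ hgenU
    (inferInstanceAs (ValuationRing X.functionField))
  have hneV : Nonempty V := ⟨⟨_, hgen⟩⟩
  have hfrac := functionField_isFractionRing_of_isAffineOpen X U hU
  have hres (t : Γ(X, U)) : X.germToFunctionField V (X.presheaf.map (homOfLE hVU).op t) =
      X.germToFunctionField U t := X.presheaf.germ_res_apply (homOfLE hVU) _ hgen t
  refine ⟨fun a b h ↦ X.germToFunctionField_injective U ?_, fun s ↦ ?_⟩
  · rw [← hres, h, hres]
  suffices h : X.germToFunctionField V s ∈ (algebraMap Γ(X, U) X.functionField).range by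
    obtain ⟨t, ht⟩ := h
    exact ⟨t, X.germToFunctionField_injective V ((hres t).trans ht)⟩
  by_contra hcon
  obtain ⟨P, hP, hpole, hval⟩ := exists_prime_valuationRing _ hcon
  let y : Spec Γ(X, U) := ⟨P, hP⟩
  have hy : hU.fromSpec y ∈ U := (hU.isoSpec.inv _).2
  let _ := TopCat.Presheaf.algebra_section_stalk X.presheaf (⟨hU.fromSpec y, hy⟩ : U)
  have hloc : IsLocalization.AtPrime (X.presheaf.stalk (hU.fromSpec y)) P :=
    hU.isLocalization_stalk' y hy
  have hyV : hU.fromSpec y ∈ V := hV _ hy (hval _)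
  -- The point of `P` lies in `V`, so `s` is regular there and has a denominator `r` outside `P`.
  -- But all denominators of `s` lie in `P`.
  obtain ⟨⟨a, r⟩, har⟩ := IsLocalization.surj P.primeCompl
    (X.presheaf.germ V (hU.fromSpec y) hyV s)
  refine r.2 (hpole a r ?_)
  have := congrArg (algebraMap (X.presheaf.stalk (hU.fromSpec y)) X.functionField) har
  rw [map_mul, Scheme.algebraMap_germ_eq_germToFunctionField] at this
  have e (c : Γ(X, U)) : algebraMap (X.presheaf.stalk (hU.fromSpec y)) X.functionField
      (algebraMap Γ(X, U) _ c) = algebraMap Γ(X, U) X.functionField c :=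
    X.algebraMap_germ_eq_germToFunctionField hy c
  rwa [e, e] at this

/-- A separated morphism of integral schemes with a section over an open subset `U` of the target is
an isomorphism over `U` if the section hits the generic point. -/
theorem isIso_morphismRestrict_of_section {X' X : Scheme.{u}} [IsIntegral X'] (χ : X' ⟶ X)
    [IsSeparated χ] (U : X.Opens) (f : U.toScheme ⟶ X') (hf : f ≫ χ = U.ι)
    (h : genericPoint X' ∈ Set.range f) : IsIso (χ ∣_ U) := by
  let f' : U.toScheme ⟶ (χ ⁻¹ᵁ U).toScheme :=
    IsOpenImmersion.lift (χ ⁻¹ᵁ U).ι f (by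
      rintro _ ⟨x, rfl⟩
      rw [Scheme.Opens.range_ι]
      change χ (f x) ∈ U
      rw [← Scheme.Hom.comp_apply, hf]
      exact x.2)
  have hf' : f' ≫ (χ ⁻¹ᵁ U).ι = f := IsOpenImmersion.lift_fac _ _ _
  have hsec : f' ≫ χ ∣_ U = 𝟙 _ := by
    rw [← cancel_mono U.ι, Category.assoc, morphismRestrict_ι, ← Category.assoc, hf', hf,
      Category.id_comp]
  have : IsSeparated (χ ∣_ U) := inferInstance
  have : IsClosedImmersion (f' ≫ χ ∣_ U) := by rw [hsec]; infer_instance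
  -- A section of a separated morphism is a closed immersion. Its image contains the generic point,
  -- so it is everything, and the source being reduced makes `f'` an isomorphism.
  have hclosed : IsClosedImmersion f' := .of_comp f' (χ ∣_ U)
  obtain ⟨x, hx⟩ := h
  have hne : Nonempty (χ ⁻¹ᵁ U) := ⟨f' x⟩
  have hx' : f' x = genericPoint (χ ⁻¹ᵁ U).toScheme := by
    apply (χ ⁻¹ᵁ U).ι.isOpenEmbedding.injective
    rw [genericPoint_eq_of_isOpenImmersion, ← Scheme.Hom.comp_apply, hf', hx]
  have hsurj : Surjective f' := by
    refine ⟨Set.range_eq_univ.mp (Set.univ_subset_iff.mp ?_)⟩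
    rw [← (genericPoint_spec (χ ⁻¹ᵁ U).toScheme).def, ← hx']
    exact (f'.isClosedEmbedding.isClosed_range).closure_subset_iff.mpr
      (Set.singleton_subset_iff.mpr ⟨x, rfl⟩)
  have hiso : IsIso f' := isIso_of_isClosedImmersion_of_surjective f'
  have : χ ∣_ U = inv f' := by rw [IsIso.eq_inv_of_hom_inv_id hsec]
  rw [this]
  infer_instance

/-- The inverse of a birational morphism on the generic point. -/
theorem exists_lift_genericPoint {X' X : Scheme.{u}} [IsIntegral X'] [IsIntegral X]
    (χ : X' ⟶ X) (hχ : IsBirationalMorphism χ) :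
    ∃ e : Spec X.functionField ⟶ X', e ≫ χ = X.fromSpecStalk (genericPoint X) ∧
      ∀ z, e z = genericPoint X' := by
  obtain ⟨φ, hφ⟩ := hχ
  have hη : genericPoint X ∈ φ.target := ((genericPoint_spec X).mem_open_set_iff
    φ.target.isOpen).mpr (by simpa using φ.dense_target.nonempty)
  have : Nonempty φ.target := ⟨⟨_, hη⟩⟩
  refine ⟨φ.target.fromSpecStalkOfMem _ hη ≫ φ.iso.inv ≫ φ.source.ι, ?_, fun z ↦ ?_⟩
  · simp only [Category.assoc, ← hφ, Iso.inv_hom_id_assoc, Scheme.Opens.fromSpecStalkOfMem_ι]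
  have h0 : X.fromSpecStalk (genericPoint X) z = genericPoint X := by
    have h1 : X.fromSpecStalk (genericPoint X) z ∈ Set.range (X.fromSpecStalk (genericPoint X)) :=
      ⟨z, rfl⟩
    rw [Scheme.range_fromSpecStalk] at h1
    exact (h1.antisymm ((genericPoint_spec X).specializes trivial)).eq
  have h1 : φ.target.fromSpecStalkOfMem _ hη z = genericPoint φ.target := by
    apply φ.target.ι.isOpenEmbedding.injective
    rw [genericPoint_eq_of_isOpenImmersion, ← Scheme.Hom.comp_apply,
      Scheme.Opens.fromSpecStalkOfMem_ι, h0]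
  rw [Scheme.Hom.comp_apply, h1, genericPoint_eq_of_isOpenImmersion]

/-- A proper birational morphism of integral schemes is an isomorphism near each point of the target
whose local ring is a valuation ring. -/
theorem exists_isIso_morphismRestrict {X' X : Scheme.{u}} [IsIntegral X'] [IsIntegral X]
    (χ : X' ⟶ X) [IsProper χ] (hχ : IsBirationalMorphism χ) (p : X)
    [hp : ValuationRing (X.presheaf.stalk p)] : ∃ U : X.Opens, p ∈ U ∧ IsIso (χ ∣_ U) := by
  obtain ⟨e, he, hgen⟩ := exists_lift_genericPoint χ hχ
  have hsq : CommSq e (Spec.map (CommRingCat.ofHom (algebraMap (X.presheaf.stalk p)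
      X.functionField))) χ (X.fromSpecStalk p) :=
    ⟨he.trans (Scheme.SpecMap_stalkSpecializes_fromSpecStalk
      ((genericPoint_spec X).specializes trivial)).symm⟩
  have hprop : ValuativeCriterion χ := by
    have h : (ValuativeCriterion ⊓ @QuasiCompact ⊓ @QuasiSeparated ⊓ @LocallyOfFiniteType) χ := by
      rw [← IsProper.eq_valuativeCriterion]; infer_instance
    exact h.1.1.1
  have hdom : IsDomain (X.presheaf.stalk p) := inferInstance
  have hfrac : IsFractionRing (X.presheaf.stalk p) X.functionField := inferInstance
  -- The inverse of `χ` at the generic point extends to the spectrum of the local ring at `p`. By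
  -- finite presentation-type spreading out, it then extends to a section over a neighbourhood of
  -- `p`.
  obtain ⟨l, hl₁, hl₂⟩ := (hprop.existence (@ValuativeCommSq.mk _ _ χ (X.presheaf.stalk p)
    inferInstance hdom hp X.functionField inferInstance inferInstance hfrac e
    (X.fromSpecStalk p) hsq)).exists_lift.some
  replace hl₁ : Spec.map (CommRingCat.ofHom (algebraMap (X.presheaf.stalk p) X.functionField)) ≫
    l = e := hl₁
  obtain ⟨U, hpU, f, hf₁, hf₂⟩ := spread_out_of_isGermInjective' (𝟙 X) χ l (by
    exact hl₂.trans (Category.comp_id _).symm)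
  rw [Category.comp_id] at hf₂
  refine ⟨U, hpU, isIso_morphismRestrict_of_section χ U f hf₂ ?_⟩
  have z : Spec X.functionField := IsLocalRing.closedPoint X.functionField
  rw [← hgen z, ← hl₁, hf₁]
  exact ⟨_, rfl⟩

/-- The largest open subset of the target over which a morphism is an isomorphism. -/
def isoLocus {X' X : Scheme.{u}} (χ : X' ⟶ X) : X.Opens :=
  ⨆ U : { U : X.Opens // IsIso (χ ∣_ U) }, U.1

theorem isIso_morphismRestrict_of_le {X' X : Scheme.{u}} (χ : X' ⟶ X) {U V : X.Opens} (h : U ≤ V)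
    [IsIso (χ ∣_ V)] : IsIso (χ ∣_ U) := by
  have h1 : IsPullback (X'.homOfLE (χ.preimage_mono h)) (χ ∣_ U) (χ ∣_ V) (X.homOfLE h) := by
    refine IsPullback.of_right ?_ ?_ (isPullback_morphismRestrict χ V).flip
    · rw [Scheme.homOfLE_ι, Scheme.homOfLE_ι]
      exact (isPullback_morphismRestrict χ U).flip
    · rw [← cancel_mono V.ι]
      simp
  exact h1.isIso_snd_of_isIso

/-- Being an isomorphism is local on the target, so a union of opens over which `χ` is an
isomorphism is another such open. -/
instance isIso_isoLocus {X' X : Scheme.{u}} (χ : X' ⟶ X) : IsIso (χ ∣_ isoLocus χ) := by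
  refine (IsZariskiLocalAtTarget.iff_of_iSup_eq_top (P := MorphismProperty.isomorphisms Scheme)
    (fun U : { U : X.Opens // IsIso (χ ∣_ U) } ↦ (isoLocus χ).ι ⁻¹ᵁ U.1) ?_).mpr fun U ↦ ?_
  · rw [← Scheme.Hom.preimage_iSup, eq_top_iff]
    exact fun x _ ↦ x.2
  · have hle : (isoLocus χ).ι ''ᵁ (isoLocus χ).ι ⁻¹ᵁ U.1 ≤ U.1 := by
      rw [Scheme.Hom.image_preimage_eq_opensRange_inf]; exact inf_le_right
    have := U.2
    have := isIso_morphismRestrict_of_le χ hle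
    exact ((MorphismProperty.isomorphisms Scheme).arrow_mk_iso_iff
      (morphismRestrictRestrict χ _ _)).mpr this

theorem mem_isoLocus {X' X : Scheme.{u}} [IsIntegral X'] [IsIntegral X]
    (χ : X' ⟶ X) [IsProper χ] (hχ : IsBirationalMorphism χ) (p : X)
    [ValuationRing (X.presheaf.stalk p)] : p ∈ isoLocus χ := by
  obtain ⟨U, hp, hU⟩ := exists_isIso_morphismRestrict χ hχ p
  exact TopologicalSpace.Opens.mem_iSup.mpr ⟨⟨U, hU⟩, hp⟩

end Birational

/-! ### The codifferential of an étale ring map -/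

section EtalePush

variable {n : ℕ} {R S B M N : Type u} [CommRing R] [CommRing S] [CommRing B]
  [Algebra R S] [Algebra R B] [Algebra S B] [IsScalarTower R S B]

theorem powTensor_powMap [AddCommGroup M] [Module R M] [AddCommGroup N] [Module R N] [Module S N]
    [IsScalarTower R S N] (d : N →ₗ[S] B ⊗[R] M) (l : M →ₗ[R] N) (h : ∀ m, d (l m) = 1 ⊗ₜ m)
    (p : SymmetricAlgebra R (Fin n → M)) :
    powTensor n d (powMap (S := S) l p) = 1 ⊗ₜ p := by
  induction p using SymmetricAlgebra.induction with
  | algebraMap r =>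
    rw [AlgHom.commutes, IsScalarTower.algebraMap_apply R S (SymmetricAlgebra S _),
      AlgHom.commutes, ← IsScalarTower.algebraMap_apply]
    exact (Algebra.TensorProduct.includeRight.commutes r).symm
  | ι v =>
    rw [powMap_ι, powTensor_ι]
    simp only [h, LinearMap.lTensor_tmul, LinearMap.comp_apply]
    rw [← TensorProduct.tmul_sum, ← map_sum]
    congr 2
    ext j
    simp [Finset.sum_apply, Pi.single_apply]
  | mul x y hx hy => rw [map_mul, map_mul, hx, hy, Algebra.TensorProduct.tmul_mul_tmul, one_mul]
  | add x y hx hy => rw [map_add, map_add, hx, hy, TensorProduct.tmul_add]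

theorem extendPoint_one_tmul [AddCommGroup M] [Module R M] (hn : IsUnit (n.factorial : R))
    (φ : multisym n R M →ₐ[R] B) (q : multisym n R M) :
    extendPoint φ (1 ⊗ₜ (q : SymmetricAlgebra R (Fin n → M))) = φ q := by
  have h := extendPoint_mul φ 1 q (1 ⊗ₜ 1)
  rwa [extendPoint_one hn, Algebra.TensorProduct.tmul_mul_tmul, mul_one, mul_one, mul_one,
    one_mul] at h

variable (k : Type u) [CommRing k] [Algebra k R] [Algebra k S] [IsScalarTower k R S]

/-- The differential of an étale map undoes the restriction of vector fields. Contraction is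
injective, so it is enough to pair both sides with exact forms `dr`, where each gives the image of
`ν(dr)` in `B`. -/
theorem tangentPush_tangentMap [Module.Finite R Ω[R⁄k]] [Module.Projective R Ω[R⁄k]]
    [Algebra.FormallyEtale R S] (ν : Tangent k R) :
    tangentPush k R S B (tangentMap k R S ν) = 1 ⊗ₜ ν := by
  apply (contraction_bijective k (R := R) (S := S) B).1
  rw [contraction_tangentPush]
  apply LinearMap.ext_on_range (KaehlerDifferential.span_range_derivation k R)
  intro r
  rw [contraction_tmul, Algebra.smul_def, mul_one]
  simp only [pullbackForms, LinearMap.coe_mk, AddHom.coe_mk, LinearMap.comp_apply,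
    KaehlerDifferential.map_D, LinearMap.restrictScalars_apply, Algebra.linearMap_apply]
  rw [tangentMap_apply, ← IsScalarTower.algebraMap_apply]

end EtalePush

/-! ### Functions on the Chow scheme under étale maps and isomorphisms -/

section ChowRing

variable {k : Type u} [CommRing k] {n : ℕ} {R S B : Type u} [CommRing R] [Algebra k R]
  [CommRing S] [Algebra k S] [CommRing B]

/-- For an étale morphism, the codifferential is a section of the restriction of functions. -/
theorem chowRingPush_chowRingMap [Algebra.Smooth k R] (hn : IsUnit (n.factorial : R))
    (f : R →ₐ[k] S) (hf : f.toRingHom.Etale) (g : S →+* B)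
    (φ : ChowRing k n R →+* B) (hφ : ∀ r, φ (algebraMap R _ r) = g (f r)) (q : ChowRing k n R) :
    chowRingPush hn f g φ hφ (chowRingMap f hf q) = φ q := by
  let _ := f.toRingHom.toAlgebra
  let _ := g.toAlgebra
  let _ := (g.comp f.toRingHom).toAlgebra
  have : IsScalarTower k R S := .of_algebraMap_eq fun r ↦ (f.commutes r).symm
  have : IsScalarTower R S B := .of_algebraMap_eq fun _ ↦ rfl
  have : Algebra.Etale R S := hf
  let φ' : ChowRing k n R →ₐ[R] B := { φ with commutes' := hφ }
  change pushPoint hn (tangentPush k R S B) φ' (multisymMap (tangentMap k R S) q) = φ' q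
  rw [pushPoint_apply, multisymMap_coe, powTensor_powMap _ _ (tangentPush_tangentMap k),
    extendPoint_one_tmul hn]

theorem chowRingMap_bijective (f : R →ₐ[k] S) (hf : f.toRingHom.Etale)
    (hb : Function.Bijective f) : Function.Bijective (chowRingMap (n := n) f hf) := by
  let e : S →ₐ[k] R := (AlgEquiv.ofBijective f hb).symm
  have he : e.toRingHom.Etale := RingHom.Etale.of_bijective (AlgEquiv.ofBijective f hb).symm.bijective
  have h1 (r) : e (f r) = r := (AlgEquiv.ofBijective f hb).symm_apply_apply r
  have h2 (s) : f (e s) = s := (AlgEquiv.ofBijective f hb).apply_symm_apply s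
  have hid {A : Type u} [CommRing A] [Algebra k A] : (AlgHom.id k A).toRingHom.Etale :=
    RingHom.Etale.of_bijective Function.bijective_id
  have e1 := chowRingMap_comp (n := n) f hf e he (AlgHom.id k R) hid fun r ↦ (h1 r).symm
  have e2 := chowRingMap_comp (n := n) e he f hf (AlgHom.id k S) hid fun s ↦ (h2 s).symm
  rw [chowRingMap_id _ _ fun _ ↦ rfl] at e1 e2
  exact Function.bijective_iff_has_inverse.mpr ⟨chowRingMap e he,
    fun x ↦ congr($e1.symm x), fun x ↦ congr($e2.symm x)⟩

end ChowRing

/-! ### Unique lifting over the iso locus -/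

section IsoLocus

theorem isIso_app_of_isIso_morphismRestrict {X' X : Scheme.{u}} (χ : X' ⟶ X) (U : X.Opens)
    [IsIso (χ ∣_ U)] : IsIso (χ.app U) := by
  have h1 : IsIso ((χ ∣_ U).appTop) := inferInstanceAs (IsIso ((χ ∣_ U).app ⊤))
  rw [morphismRestrict_appTop] at h1
  have hmap {V V' : X'.Opens} (e : V = V') : IsIso (X'.presheaf.map (eqToHom e).op) := by
    subst e; rw [eqToHom_refl, op_id, CategoryTheory.Functor.map_id]; infer_instance
  have h2 : IsIso (χ.app (U.ι ''ᵁ ⊤)) := by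
    have := hmap (image_morphismRestrict_preimage χ U ⊤)
    exact @IsIso.of_isIso_comp_right _ _ _ _ _ _ _ this h1
  have h3 (V : X.Opens) (h : V = U.ι ''ᵁ ⊤) : IsIso (χ.app V) := by subst h; exact h2
  exact h3 U U.ι_image_top.symm

variable {P C Z : Scheme.{u}} (g : P ⟶ C)

/-- Together with `eq_of_mem_isoLocus`, this allows the codifferential to be inverted on morphisms
that land where it is an isomorphism. It need not be one globally. -/
theorem exists_lift_of_mem_isoLocus (z : Z ⟶ C) (hz : ∀ x, z x ∈ isoLocus g) :
    ∃ p : Z ⟶ P, p ≫ g = z := by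
  have hr : Set.range z ⊆ Set.range (isoLocus g).ι := by
    rintro _ ⟨x, rfl⟩
    rw [Scheme.Opens.range_ι]
    exact hz x
  refine ⟨IsOpenImmersion.lift (isoLocus g).ι z hr ≫ inv (g ∣_ isoLocus g) ≫
    (g ⁻¹ᵁ isoLocus g).ι, ?_⟩
  rw [Category.assoc, Category.assoc, ← morphismRestrict_ι, IsIso.inv_hom_id_assoc,
    IsOpenImmersion.lift_fac]

theorem eq_of_mem_isoLocus {p₁ p₂ : Z ⟶ P} (h : p₁ ≫ g = p₂ ≫ g)
    (hz : ∀ x, (p₁ ≫ g) x ∈ isoLocus g) : p₁ = p₂ := by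
  have hr (p : Z ⟶ P) (hp : p ≫ g = p₁ ≫ g) : Set.range p ⊆ Set.range (g ⁻¹ᵁ isoLocus g).ι := by
    rintro _ ⟨x, rfl⟩
    rw [Scheme.Opens.range_ι]
    change g (p x) ∈ isoLocus g
    rw [← Scheme.Hom.comp_apply, hp]
    exact hz x
  have e (p : Z ⟶ P) (hp : p ≫ g = p₁ ≫ g) :=
    IsOpenImmersion.lift_fac (g ⁻¹ᵁ isoLocus g).ι p (hr p hp)
  rw [← e p₁ rfl, ← e p₂ h.symm]
  congr 1
  rw [← cancel_mono (g ∣_ isoLocus g), ← cancel_mono (isoLocus g).ι, Category.assoc,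
    Category.assoc, morphismRestrict_ι, ← Category.assoc, ← Category.assoc, e _ rfl, e _ h.symm, h]

/-- An open subscheme over which a morphism has an isomorphism as base change lies in its iso locus. -/
theorem range_le_isoLocus {Q V : Scheme.{u}} {i : Q ⟶ P} {m : Q ⟶ V} {j : V ⟶ C}
    (H : IsPullback i m g j) [IsOpenImmersion j] [IsIso m] : j.opensRange ≤ isoLocus g := by
  have h1 : IsIso (pullback.snd g j) := by
    rw [← H.isoPullback_inv_snd]; infer_instance
  have h2 : IsIso (g ∣_ j.opensRange) :=
    ((MorphismProperty.isomorphisms Scheme).arrow_mk_iso_iff (morphismRestrictOpensRange g j)).mpr h1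
  exact le_iSup (fun U : { U : C.Opens // IsIso (g ∣_ U) } ↦ U.1) ⟨_, h2⟩

end IsoLocus

/-! ### The codifferential is an isomorphism where the base morphism is -/

section Codifferential

variable {k : Type u} [Field k] [CharZero k] (n : ℕ) {X' X : Over (Spec (.of k))} (χ : X' ⟶ X)
  [Smooth X.hom] [Smooth X'.hom]

theorem isPullback_chowPiece (i : ChartPair χ.left) :
    IsPullback (chowPieceι n χ i) (coverToBase n χ i) (chowPullback n χ).hom
      i.1.1.2.fromSpec := by
  refine IsPullback.of_iso (IsPullback.of_hasPullback (chowPullback n χ).hom i.1.1.toOpens.ι)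
    (Iso.refl _) (Iso.refl _) i.1.1.2.isoSpec (Iso.refl _) ?_ ?_ ?_ ?_
  · exact (Category.comp_id _).trans (Category.id_comp _).symm
  · simp [coverToBase]
  · simp
  · simp

/-- Pasting of cartesian squares: base change of the Chow scheme from `X` to `U'` can be computed
from the chart over `U`. In particular `coverToChow` is an isomorphism when `Γ(U) → Γ(U')` is. -/
theorem isPullback_coverToChow (i : ChartPair χ.left) :
    IsPullback (coverToChow n χ i) (coverToBase n χ i) (Spec.map (chowStructure n X i.1.2))
      (Spec.map (χ.left.appLE i.1.2.toOpens i.1.1.toOpens i.2)) := by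
  have h1 := (isPullback_chowChart n X i.1.2).flip
  refine IsPullback.of_right ?_ (coverToChow_structure n χ i) h1
  have h2 : IsPullback (pullback.fst (Chow n X).hom χ.left) (chowPullback n χ).hom
      (Chow n X).hom χ.left := IsPullback.of_hasPullback _ _
  have h4 := (isPullback_chowPiece n χ i).paste_horiz h2
  rw [← IsAffineOpen.SpecMap_appLE_fromSpec _ i.1.2.2 i.1.1.2 i.2] at h4
  convert h4 using 1
  exact (isPullback_chowChart n X i.1.2).lift_snd _ _ _

theorem chowPieceι_codifferential (i : ChartPair χ.left) :
    chowPieceι n χ i ≫ (codifferential n χ).left = coverCodiff n χ i :=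
  (chowPullbackCover n χ).map_glueMorphismsOverOfLocallyDirected_left (coverCodiff n χ)
    (fun hij ↦ comp_coverCodiff n χ (leOfHom (X := ChartPair χ.left) hij) _
      ((chowPullbackCover n χ).trans_map hij)) (coverCodiff_hom n χ) i

/-- The codifferential is a morphism over `X'`, so its base change to a chart is its base change to
`U'`. Thus the local formula is the codifferential over `U'`, and isomorphy can be tested on it. -/
theorem isPullback_localCodiff (i : ChartPair χ.left) :
    IsPullback (chowPieceι n χ i)
      (localCodiff n χ i.2 (coverToBase n χ i) (coverToChow n χ i) (coverToChow_structure n χ i))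
      (codifferential n χ).left (chowChart n X' i.1.1) := by
  have h1 := isPullback_chowChart n X' i.1.1
  refine IsPullback.of_bot ?_ (chowPieceι_codifferential n χ i) h1.flip
  convert isPullback_chowPiece n χ i using 1
  · exact localCodiff_structure n χ i.2 _ _ _
  · exact Over.w (codifferential n χ)

/-- The map `r` induced on Chow rings by the isomorphism `Γ(U) ≅ Γ(U')` is an isomorphism, and
composing the codifferential with `Spec.map r` gives `coverToChow`, by `chowRingPush_chowRingMap`.
The latter is also an isomorphism. -/
theorem isIso_localCodiff (i : ChartPair χ.left)
    (hi : IsIso (χ.left.appLE i.1.2.toOpens i.1.1.toOpens i.2)) :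
    IsIso (localCodiff n χ i.2 (coverToBase n χ i) (coverToChow n χ i)
      (coverToChow_structure n χ i)) := by
  have := smooth_section X i.1.2.2
  have hb : Function.Bijective (pullbackSections χ i.1.2.toOpens i.1.1.toOpens i.2) :=
    ConcreteCategory.bijective_of_isIso (χ.left.appLE i.1.2.toOpens i.1.1.toOpens i.2)
  have he : (pullbackSections χ i.1.2.toOpens i.1.1.toOpens i.2).toRingHom.Etale :=
    RingHom.Etale.of_bijective hb
  let r : chowSections n X i.1.2 ⟶ chowSections n X' i.1.1 :=
    CommRingCat.ofHom (chowRingMap (pullbackSections χ i.1.2.toOpens i.1.1.toOpens i.2) he)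
  have hr : IsIso r := (ConcreteCategory.isIso_iff_bijective r).mpr (chowRingMap_bijective _ he hb)
  have h1 : r ≫ localCodiffRing n χ i.2 (coverToBase n χ i) (coverToChow n χ i)
      (coverToChow_structure n χ i) = coordHom (coverToChow n χ i) := by
    ext q
    exact chowRingPush_chowRingMap (isUnit_factorial (k := k) n Γ(X.left, i.1.2.toOpens)) _ he _ _ _ q
  have h2 : IsIso (coverToChow n χ i) := (isPullback_coverToChow n χ i).isIso_fst_of_isIso
  have h3 : localCodiff n χ i.2 (coverToBase n χ i) (coverToChow n χ i)
      (coverToChow_structure n χ i) ≫ Spec.map r = coverToChow n χ i := by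
    rw [localCodiff, Category.assoc, ← Spec.map_comp, h1, toSpecΓ_map_coordHom]
  rw [← h3] at h2
  exact IsIso.of_isIso_comp_right _ (Spec.map r)

/-- The codifferential is an isomorphism over the open subsets over which `χ` is an isomorphism. -/
theorem mem_isoLocus_codifferential (c : (Chow n X').left)
    (hc : χ.left ((Chow n X').hom c) ∈ isoLocus χ.left) :
    c ∈ isoLocus (codifferential n χ).left := by
  obtain ⟨_, ⟨U, hU, rfl⟩, hxU, hle⟩ :=
    X.left.isBasis_affineOpens.exists_subset_of_mem_open hc (isoLocus χ.left).2
  have h1 : IsIso (χ.left ∣_ U) := isIso_morphismRestrict_of_le χ.left hle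
  have hU' : IsAffineOpen (χ.left ⁻¹ᵁ U) := by
    have : IsAffine U := hU
    exact IsAffine.of_isIso (χ.left ∣_ U)
  -- The full preimage of `U` is affine, being isomorphic to `U`, so it can serve as the chart `U'`.
  -- The point `c` lies over `U'` and hence in this chart of the Chow scheme.
  let i : ChartPair χ.left := ⟨(⟨_, hU'⟩, ⟨U, hU⟩), le_rfl⟩
  have h2 : IsIso (χ.left.appLE U (χ.left ⁻¹ᵁ U) le_rfl) := by
    rw [← Scheme.Hom.app_eq_appLE]
    exact isIso_app_of_isIso_morphismRestrict χ.left U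
  have h3 := isIso_localCodiff n χ i h2
  have h4 : IsOpenImmersion (chowChart n X' i.1.1) := 
    MorphismProperty.of_isPullback (isPullback_chowChart n X' i.1.1) inferInstance
  refine range_le_isoLocus _ (isPullback_localCodiff n χ i) ?_
  have h5 := isPullback_chowChart n X' i.1.1
  have h6 : (Chow n X').hom c ∈ Set.range i.1.1.2.fromSpec := by
    rw [i.1.1.2.range_fromSpec]; exact hxU
  obtain ⟨y, hy⟩ := h6
  obtain ⟨z, hz, -⟩ := Scheme.exists_preimage_of_isPullback h5.flip c y hy.symm
  exact ⟨z, hz⟩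

end Codifferential

/-! ### Bijectivity of the map on spectral data -/

section Main

/-- The inclusion `χ⁻¹(W) → X` of the part of the source over the iso locus `W` of `χ`. -/
abbrev isoLocusι {X' X : Scheme.{u}} (χ : X' ⟶ X) : (χ ⁻¹ᵁ isoLocus χ).toScheme ⟶ X :=
  (χ ⁻¹ᵁ isoLocus χ).ι ≫ χ

/-- Restriction to the iso locus is bijective by the Hartogs property, and `χ` is an isomorphism
over it. The statement is about `χ⁻¹(W)`, not `W`, because the section to be extended is constructed
on the `X'` side. -/
theorem bijective_app_isoLocusι {X' X : Scheme.{u}} [IsIntegral X'] [IsIntegral X]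
    (χ : X' ⟶ X) [IsProper χ] (hχ : IsBirationalMorphism χ) {U : X.Opens} (hU : IsAffineOpen U)
    [IsNoetherianRing Γ(X, U)]
    (hn : Nonempty U → IsIntegrallyClosed Γ(X, U)) :
    Function.Bijective ((isoLocusι χ).app U) := by
  rw [isoLocusι, ← morphismRestrict_ι, Scheme.Hom.comp_app]
  have h1 : Function.Bijective ((isoLocus χ).ι.app U) :=
    bijective_restrict_of_forall_valuationRing hU hn ((isoLocus χ).ι.image_preimage_le U)
      fun x hx _ ↦ ⟨⟨x, mem_isoLocus χ hχ x⟩, hx, rfl⟩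
  exact (ConcreteCategory.bijective_of_isIso ((χ ∣_ isoLocus χ).app _)).comp h1

variable {k : Type u} [Field k]

theorem isNoetherianRing_section (X : Over (Spec (.of k))) [Smooth X.hom] {U : X.left.Opens}
    (hU : IsAffineOpen U) : IsNoetherianRing Γ(X.left, U) := by
  have := smooth_section X hU
  exact Algebra.FiniteType.isNoetherianRing k _

/-- The preimage of an affine open `U` is the image of the chart over `U`, which is affine. -/
instance isAffineHom_chow (n : ℕ) (X : Over (Spec (.of k))) [Smooth X.hom] :
    IsAffineHom (Chow n X).hom := by
  refine isAffineHom_of_forall_exists_isAffineOpen _ fun x ↦ ?_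
  obtain ⟨_, ⟨U, hU, rfl⟩, hxU, -⟩ :=
    X.left.isBasis_affineOpens.exists_subset_of_mem_open (Set.mem_univ x) isOpen_univ
  refine ⟨U, hxU, hU, ?_⟩
  have h := isPullback_chowChart n X ⟨U, hU⟩
  have : IsOpenImmersion (chowChart n X ⟨U, hU⟩) :=
    MorphismProperty.of_isPullback h inferInstance
  convert isAffineOpen_opensRange (chowChart n X ⟨U, hU⟩)
  ext c
  refine ⟨fun hc ↦ ?_, ?_⟩
  · have h1 : (Chow n X).hom c ∈ Set.range hU.fromSpec := by
      rw [hU.range_fromSpec]; exact hc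
    obtain ⟨y, hy⟩ := h1
    obtain ⟨z, hz, -⟩ := Scheme.exists_preimage_of_isPullback h.flip c y hy.symm
    exact ⟨z, hz⟩
  · rintro ⟨z, rfl⟩
    change (Chow n X).hom (chowChart n X ⟨U, hU⟩ z) ∈ U
    rw [← Scheme.Hom.comp_apply, ← h.w]
    exact hU.range_fromSpec.le ⟨_, rfl⟩

theorem isLocallyNoetherian_of_smooth (X : Over (Spec (.of k))) [Smooth X.hom] :
    IsLocallyNoetherian X.left :=
  LocallyOfFiniteType.isLocallyNoetherian X.hom

theorem isDominant_of_isBirationalMorphism {X' X : Scheme.{u}} (χ : X' ⟶ X)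
    (hχ : IsBirationalMorphism χ) : IsDominant χ := by
  obtain ⟨φ, hφ⟩ := hχ
  have : IsDominant φ.target.ι := ⟨by
    rw [DenseRange, Scheme.Opens.range_ι]; exact φ.dense_target⟩
  have : IsDominant (φ.source.ι ≫ χ) := by rw [← hφ]; infer_instance
  exact IsDominant.of_comp φ.source.ι χ

theorem isDominant_preimage_isoLocus {X' X : Scheme.{u}} [IsIntegral X'] [IsIntegral X]
    (χ : X' ⟶ X) [IsProper χ] (hχ : IsBirationalMorphism χ) :
    IsDominant (χ ⁻¹ᵁ isoLocus χ).ι := by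
  have h1 : genericPoint X ∈ isoLocus χ := by
    have : ValuationRing (X.presheaf.stalk (genericPoint X)) :=
      inferInstanceAs (ValuationRing X.functionField)
    exact mem_isoLocus χ hχ _
  have h2 : Nonempty (χ ⁻¹ᵁ isoLocus χ) := by
    have := isDominant_of_isBirationalMorphism χ hχ
    obtain ⟨x, hx⟩ := χ.denseRange.exists_mem_open (isoLocus χ).2 ⟨_, h1⟩
    exact ⟨⟨x, hx⟩⟩
  refine ⟨?_⟩
  rw [DenseRange, Scheme.Opens.range_ι]
  exact (χ ⁻¹ᵁ isoLocus χ).2.dense ⟨_, h2.some.2⟩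

variable (n : ℕ) {X' X : Over (Spec (.of k))} (χ : X' ⟶ X)

/-- This square is what allows properties of `χ` to be transported to `T ×_k X' → T ×_k X` along the
flat projection to `X`. -/
theorem isPullback_baseChangeMap (T : Over (Spec (.of k))) :
    IsPullback (pullback.snd T.hom X'.hom) (baseChangeMap χ T) χ.left
      (pullback.snd T.hom X.hom) := by
  refine (IsPullback.of_right (h₁₂ := pullback.fst T.hom X.hom) (v₁₃ := T.hom) (h₂₂ := X.hom)
    ?_ (pullback.lift_snd _ _ _) (IsPullback.of_hasPullback T.hom X.hom)).flip
  rw [Over.w χ]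
  convert IsPullback.of_hasPullback T.hom X'.hom using 1
  exact pullback.lift_fst _ _ _

/-- The inclusion of the part of `T ×_k X'` over the iso locus of `χ`. -/
abbrev productIsoLocusι (T : Over (Spec (.of k))) :
    pullback (χ.left ⁻¹ᵁ isoLocus χ.left).ι (pullback.snd T.hom X'.hom) ⟶
      ((Over.pullback X'.hom).obj T).left :=
  pullback.snd _ _

variable [IsIntegral X.left] [Smooth X.hom] [IsIntegral X'.left] [Smooth X'.hom]

/-- A dense open subset of the reduced scheme `X'` is scheme-theoretically dense, and flat base
change along `T ×_k X' → X'` preserves this. Topological density would not suffice for non-reduced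
`T`. -/
theorem isSchemeTheoreticallyDominant_productIsoLocusι [IsProper χ.left]
    (hχ : IsBirationalMorphism χ.left) (T : Over (Spec (.of k))) :
    IsSchemeTheoreticallyDominant (productIsoLocusι χ T) := by
  have := isLocallyNoetherian_of_smooth X'
  have := isDominant_preimage_isoLocus χ.left hχ
  have := IsSchemeTheoreticallyDominant.of_isDominant (χ.left ⁻¹ᵁ isoLocus χ.left).ι
  exact IsSchemeTheoreticallyDominant.pullbackSnd _ _

theorem isSchemeTheoreticallyDominant_baseChangeMap [IsProper χ.left]
    (hχ : IsBirationalMorphism χ.left) (T : Over (Spec (.of k))) :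
    IsSchemeTheoreticallyDominant (baseChangeMap χ T) := by
  have := isDominant_of_isBirationalMorphism χ.left hχ
  have := IsSchemeTheoreticallyDominant.of_isDominant χ.left
  exact IsSchemeTheoreticallyDominant.of_isPullback (isPullback_baseChangeMap χ T)

variable [CharZero k]

theorem productIsoLocusι_mem_isoLocus (T : Over (Spec (.of k)))
    (b : (Over.pullback X'.hom).obj T ⟶ Chow n X') (x) :
    (productIsoLocusι χ T ≫ b.left) x ∈ isoLocus (codifferential n χ).left := by
  apply mem_isoLocus_codifferential
  have h : (productIsoLocusι χ T ≫ b.left) ≫ (Chow n X').hom =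
      pullback.fst _ _ ≫ (χ.left ⁻¹ᵁ isoLocus χ.left).ι := by
    rw [Category.assoc, Over.w b]
    exact pullback.condition.symm
  have hx := Scheme.Hom.comp_apply (productIsoLocusι χ T ≫ b.left) (Chow n X').hom x
  rw [h] at hx
  have hmem : (Chow n X').hom ((productIsoLocusι χ T ≫ b.left) x) ∈
      χ.left ⁻¹ᵁ isoLocus χ.left := by
    rw [← hx]
    exact (pullback.fst (χ.left ⁻¹ᵁ isoLocus χ.left).ι (pullback.snd T.hom X'.hom) x).2
  exact hmem

theorem pullbackSpectralData_fst {T : Over (Spec (.of k))}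
    (a : (Over.pullback X.hom).obj T ⟶ Chow n X) :
    (pullbackSpectralData n χ a).left ≫ pullback.fst (Chow n X).hom χ.left =
      baseChangeMap χ T ≫ a.left :=
  pullback.lift_fst _ _ _

instance isSeparated_chowPullback : IsSeparated (chowPullback n χ).hom :=
  inferInstanceAs (IsSeparated (pullback.snd (Chow n X).hom χ.left))

theorem spectralDataMap_injective [IsProper χ.left] (hχ : IsBirationalMorphism χ.left)
    (T : Over (Spec (.of k))) (a₁ a₂ : (Over.pullback X.hom).obj T ⟶ Chow n X)
    (h : pullbackSpectralData n χ a₁ ≫ codifferential n χ =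
      pullbackSpectralData n χ a₂ ≫ codifferential n χ) : a₁ = a₂ := by
  have hi := isSchemeTheoreticallyDominant_productIsoLocusι χ hχ T
  have hb := isSchemeTheoreticallyDominant_baseChangeMap χ hχ T
  have h1 : productIsoLocusι χ T ≫ (pullbackSpectralData n χ a₁).left =
      productIsoLocusι χ T ≫ (pullbackSpectralData n χ a₂).left := by
    -- Over `χ⁻¹(W)` the codifferential can be cancelled. Density then gives equality over `T ×_k
    -- X'`, and dominance of `T ×_k X' → T ×_k X` gives equality over `T ×_k X`.
    refine eq_of_mem_isoLocus (codifferential n χ).left ?_ ?_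
    · rw [Category.assoc, Category.assoc, ← Over.comp_left, ← Over.comp_left, h]
    · rw [Category.assoc, ← Over.comp_left]
      exact productIsoLocusι_mem_isoLocus n χ T _
  have h2 : (pullbackSpectralData n χ a₁).left = (pullbackSpectralData n χ a₂).left :=
    ext_of_isSchemeTheoreticallyDominant (chowPullback n χ).hom
      ((Over.w _).trans (Over.w _).symm) _ h1
  have h3 : baseChangeMap χ T ≫ a₁.left = baseChangeMap χ T ≫ a₂.left := by
    rw [← pullbackSpectralData_fst, ← pullbackSpectralData_fst, h2]
  ext1
  exact ext_of_isSchemeTheoreticallyDominant (Chow n X).hom ((Over.w _).trans (Over.w _).symm) _ h3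

theorem spectralDataMap_surjective [IsProper χ.left] (hχ : IsBirationalMorphism χ.left)
    (T : Over (Spec (.of k))) (b : (Over.pullback X'.hom).obj T ⟶ Chow n X') :
    ∃ a : (Over.pullback X.hom).obj T ⟶ Chow n X,
      pullbackSpectralData n χ a ≫ codifferential n χ = b := by
  have hi := isSchemeTheoreticallyDominant_productIsoLocusι χ hχ T
  have := isLocallyNoetherian_of_smooth X'
  obtain ⟨p, hp⟩ := exists_lift_of_mem_isoLocus (codifferential n χ).left
    (productIsoLocusι χ T ≫ b.left) (productIsoLocusι_mem_isoLocus n χ T b)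
  have hp' : p ≫ (chowPullback n χ).hom =
      productIsoLocusι χ T ≫ ((Over.pullback X'.hom).obj T).hom := by
    rw [← Over.w (codifferential n χ), ← Category.assoc, hp, Category.assoc, Over.w b]
  -- The part of `T ×_k X'` over `χ⁻¹(W)` is also the base change of `χ⁻¹(W) → X` along `T ×_k X →
  -- X`. The extension theorem applies to this square.
  have H := (IsPullback.of_hasPullback (χ.left ⁻¹ᵁ isoLocus χ.left).ι
    (pullback.snd T.hom X'.hom)).paste_vert (isPullback_baseChangeMap χ T)
  have hw (U : X.left.Opens) (hU : IsAffineOpen U) :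
      Function.Bijective ((isoLocusι χ.left).app U) := by
    have := isNoetherianRing_section X hU
    refine bijective_app_isoLocusι χ.left hχ hU fun _ ↦ ?_
    have := smooth_section X hU
    exact isIntegrallyClosed_of_smooth k _
  obtain ⟨a, ha₁, ha₂⟩ := exists_extension H hw (Chow n X).hom
    (p ≫ pullback.fst (Chow n X).hom χ.left) (by
      rw [Category.assoc, pullback.condition, Category.assoc, ← (isPullback_baseChangeMap χ T).w,
        ← Category.assoc, ← Category.assoc]
      exact congrArg (· ≫ χ.left) hp')
  refine ⟨Over.homMk a ha₂, ?_⟩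
  ext1
  -- The image of `a` and the given `b` are compared only over `χ⁻¹(W)`, where the pullback of `a`
  -- is the lift `p` by construction.
  refine ext_of_isSchemeTheoreticallyDominant (Chow n X').hom ((Over.w _).trans (Over.w _).symm)
    (productIsoLocusι χ T) ?_
  have h1 : productIsoLocusι χ T ≫
      (pullbackSpectralData n χ (Over.homMk a ha₂ : (Over.pullback X.hom).obj T ⟶ _)).left = p := by
    apply pullback.hom_ext
    · rw [Category.assoc, pullbackSpectralData_fst, ← ha₁, Category.assoc]
      rfl
    · refine Eq.trans ?_ hp'.symm
      rw [Category.assoc]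
      exact congrArg _ (Over.w (pullbackSpectralData n χ
        (Over.homMk a ha₂ : (Over.pullback X.hom).obj T ⟶ _)))
  rw [Over.comp_left, ← Category.assoc, h1, hp]

theorem isIso_spectralDataMap [IsProper χ.left] (hχ : IsBirationalMorphism χ.left) :
    IsIso (spectralDataMap n χ) := by
  have (T : (Over (Spec (.of k)))ᵒᵖ) : IsIso ((spectralDataMap n χ).app T) := by
    rw [isIso_iff_bijective]
    exact ⟨fun a₁ a₂ h ↦ spectralDataMap_injective n χ hχ T.unop a₁ a₂ h,
      spectralDataMap_surjective n χ hχ T.unop⟩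
  exact NatIso.isIso_of_isIso_app _

end Main

end SpectralData

end

theorem theorem303 {k : Type u} [Field k] [IsAlgClosed k] [CharZero k] (n : ℕ)
    {X' X : Over (Spec (CommRingCat.of k))}
    [IsIntegral X.left] [Smooth X.hom] [IsSeparated X.hom] [QuasiCompact X.hom]
    [IsIntegral X'.left] [Smooth X'.hom] [IsSeparated X'.hom] [QuasiCompact X'.hom]
    (χ : X' ⟶ X) [IsProper χ.left] (hχ : SpectralData.IsBirationalMorphism χ.left) :
    IsIso (SpectralData.spectralDataMap n χ) ∧
      ∀ (A A' : Over (Spec (CommRingCat.of k)))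
        (r : (SpectralData.spectralData n X).RepresentableBy A)
        (r' : (SpectralData.spectralData n X').RepresentableBy A'),
        IsIso (r'.homEquiv.symm
          ((SpectralData.spectralDataMap n χ).app (op A) (r.homEquiv (𝟙 A))) : A ⟶ A') := by
  have h := SpectralData.isIso_spectralDataMap n χ hχ
  refine ⟨h, fun A A' r r' ↦ ?_⟩
  -- Under the two representations, the morphism of schemes corresponds to the natural
  -- transformation. The Yoneda embedding is fully faithful, so it reflects isomorphisms.
  have e : yoneda.map (r'.homEquiv.symm
      ((SpectralData.spectralDataMap n χ).app (op A) (r.homEquiv (𝟙 A))) : A ⟶ A') =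
      r.toIso.hom ≫ SpectralData.spectralDataMap n χ ≫ r'.toIso.inv := by
    rw [← Category.assoc, Iso.eq_comp_inv]
    apply yonedaEquiv.injective
    rw [yonedaEquiv_apply, yonedaEquiv_apply]
    change r'.homEquiv (𝟙 A ≫ _) = (SpectralData.spectralDataMap n χ).app (op A) (r.homEquiv (𝟙 A))
    rw [Category.id_comp, Equiv.apply_symm_apply]
  have : IsIso (yoneda.map (r'.homEquiv.symm
      ((SpectralData.spectralDataMap n χ).app (op A) (r.homEquiv (𝟙 A))) : A ⟶ A')) := by
    rw [e]; infer_instance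
  exact isIso_of_fully_faithful yoneda _
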